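/- **Theorem 7 (optimality for recursive LCP theories is in EXPTIME).** A *logical conditional preference (LCP) theory* over $N$ features consists of a finite nonempty set of constants, a finite set $D_i$ of constants (the domain of values) for each feature $i=1,\dots,N$, with a domain predicate $d_i$ that holds exactly of the elements of $D_i$, and a finite set of clauses $h \leftarrow c, g_1,\dots,g_k$ with $k\ge 0$ (a clause is recursive if $k>0$; arbitrarily many recursive clauses are allowed). Write an outcome term $o(t_1,\dots,t_N)$ for an $N$-tuple of terms, each a variable or a constant. The head $h$ is an atom $d(S,T)$ ("$S$ is preferred to $T$") or $\mathit{outcome}(S)$ with outcome terms $S,T$, or an atom $p(t_1,\dots,t_m)$ of a user-defined predicate; $c$ is a quantifier-free formula over equality; and each goal $g_j$ is an atom of one of these kinds, or $d_i(t)$, or $\mathit{dom}(S,T)$. Let $\mathcal L(P)$ be the theory $P$ together with the clauses $$\mathit{dom}(X,Y)\leftarrow d(X,Y),\,\mathit{outcome}(X),\,\mathit{outcome}(Y);\qquad \mathit{dom}(X,Y)\leftarrow d(X,Z),\,\mathit{dom}(Z,Y),$$ and let $\mathcal L(P)\vdash A$ mean that the ground atom $A$ is derivable, variables ranging over the constants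 and distinct constants being distinct. A tuple $s$ of $N$ constants is an *optimal outcome* of $P$ if $\mathcal L(P)\vdash \mathit{outcome}(s)$ and there is no $t\neq s$ with $\mathcal L(P)\vdash \mathit{outcome}(t)$ and $\mathcal L(P)\vdash \mathit{dom}(t,s)$. The following problem is in EXPTIME in the sense of combined complexity: given $N$, an LCP theory $P$ over $N$ features and a tuple $s$ of $N$ constants, decide whether $s$ is an optimal outcome of $P$. That is, there are a deterministic (multi-stack) Turing machine and a polynomial $p$ such that on every input $(N,P,s)$, written as a word of length $n$ (so $n\ge N$) over a fixed finite alphabet, the machine halts with the correct answer after at most $2^{p(n)}$ steps. -/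

import Mathlib

/-! ### Syntax of logical conditional preference (LCP) theories

A theory is written over `N` features and `K` constants, the constants being the elements of
`Fin K`.  The only function symbol is `o/N`, which forms outcome terms; an outcome term
`o(t₁, …, t_N)` is the tuple `Fin N → Term K` of its arguments. -/

namespace LCP

/-- Terms denoting feature values: variables and constants. -/
inductive Term (K : ℕ) : Type
  | var (v : ℕ)
  | const (c : Fin K)

/-- The instance of a term under an assignment of constants to the variables. -/
def Term.eval {K : ℕ} (σ : ℕ → Fin K) : Term K → Fin K
  | .var v => σ v
  | .const c => c

/-- The constraint of a clause: a quantifier-free formula over equality. -/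
inductive Constraint (K : ℕ) : Type
  | true
  | eq (t u : Term K)
  | not (c : Constraint K)
  | and (c e : Constraint K)
  | or (c e : Constraint K)

/-- Truth of a constraint under an assignment (distinct constants denote distinct values). -/
def Constraint.Holds {K : ℕ} (σ : ℕ → Fin K) : Constraint K → Prop
  | .true => True
  | .eq t u => t.eval σ = u.eval σ
  | .not c => ¬ c.Holds σ
  | .and c e => c.Holds σ ∧ e.Holds σ
  | .or c e => c.Holds σ ∨ e.Holds σ

/-- The atoms that the clauses of a theory may define, with arguments in `τ`:
`d(S, T)`, `outcome(S)`, and `p(t₁, …, t_k)` for auxiliary user-defined predicates.  Auxiliary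
predicates are identified by name and arity and take feature values as arguments; an argument
that is an outcome is written as its `N` components. -/
inductive Head (N : ℕ) (τ : Type) : Type
  | pref (s t : Fin N → τ)
  | outcome (s : Fin N → τ)
  | user (p : ℕ) (args : List τ)

/-- The atoms that may occur as goals in a clause body: those above, together with the domain
predicates `d_i(t)` of the features and the dominance atoms `dom(S, T)`. -/
inductive Atom (N : ℕ) (τ : Type) : Type
  | ofHead (h : Head N τ)
  | feature (i : Fin N) (t : τ)
  | dom (s t : Fin N → τ)

/-- Apply a function to all arguments of a head atom. -/
def Head.map {N : ℕ} {τ υ : Type} (f : τ → υ) : Head N τ → Head N υ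
  | .pref s t => .pref (f ∘ s) (f ∘ t)
  | .outcome s => .outcome (f ∘ s)
  | .user p args => .user p (args.map f)

/-- Apply a function to all arguments of an atom. -/
def Atom.map {N : ℕ} {τ υ : Type} (f : τ → υ) : Atom N τ → Atom N υ
  | .ofHead h => .ofHead (h.map f)
  | .feature i t => .feature i (f t)
  | .dom s t => .dom (f ∘ s) (f ∘ t)

/-- A clause `head :- constraint, g₁, …, g_k`; it is recursive if `k > 0` and flat if `k = 0`. -/
structure Clause (N K : ℕ) : Type where
  head : Head N (Term K)
  constraint : Constraint K
  body : List (Atom N (Term K))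

/-- A (recursive) LCP theory over `N` features and `K` constants: the values of each feature, and
finitely many clauses for `d`, `outcome` and auxiliary predicates.  Any clause may be recursive.
The vocabulary contains at least one constant. -/
structure Theory (N K : ℕ) : Type where
  constants_pos : 0 < K
  values : Fin N → List (Fin K)
  clauses : List (Clause N K)

/-! ### Semantics -/

/-- Derivability of ground atoms from a theory together with the runtime clauses
```
dom(X,Y) :- d(X,Y), outcome(X), outcome(Y).
dom(X,Y) :- d(X,Z), dom(Z,Y).
```
Variables range over the constants of the vocabulary. -/
inductive Theory.Derivable {N K : ℕ} (P : Theory N K) : Atom N (Fin K) → Prop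
  | feature (i : Fin N) (c : Fin K) (hc : c ∈ P.values i) : P.Derivable (.feature i c)
  | clause (C : Clause N K) (hC : C ∈ P.clauses) (σ : ℕ → Fin K) (hc : C.constraint.Holds σ)
      (hb : ∀ B ∈ C.body, P.Derivable (B.map (Term.eval σ))) :
      P.Derivable (.ofHead (C.head.map (Term.eval σ)))
  | dom_base (x y : Fin N → Fin K) (hd : P.Derivable (.ofHead (.pref x y)))
      (hx : P.Derivable (.ofHead (.outcome x))) (hy : P.Derivable (.ofHead (.outcome y))) :
      P.Derivable (.dom x y)
  | dom_step (x z y : Fin N → Fin K) (hd : P.Derivable (.ofHead (.pref x z)))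
      (hz : P.Derivable (.dom z y)) : P.Derivable (.dom x y)

/-- The tuple `s` is an outcome of the theory: it satisfies the hard constraints. -/
def Theory.IsOutcome {N K : ℕ} (P : Theory N K) (s : Fin N → Fin K) : Prop :=
  P.Derivable (.ofHead (.outcome s))

/-- Outcome `s` dominates (is preferred to) `t`. -/
def Theory.Dominates {N K : ℕ} (P : Theory N K) (s t : Fin N → Fin K) : Prop :=
  P.Derivable (.dom s t)

/-- `s` is an optimal outcome: an outcome that no other outcome dominates. -/
def Theory.IsOptimal {N K : ℕ} (P : Theory N K) (s : Fin N → Fin K) : Prop :=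
  P.IsOutcome s ∧ ¬ ∃ t, t ≠ s ∧ P.IsOutcome t ∧ P.Dominates t s

/-- An input of the optimality problem: the number of features, the number of constants, a theory,
and a tuple of feature values. -/
structure OptInput : Type where
  N : ℕ
  K : ℕ
  theory : Theory N K
  query : Fin N → Fin K

/-! ### Writing inputs as words

Expressions are written in prefix notation, numbers in binary (least significant bit first). -/

/-- The finite alphabet in which theories and queries are written. -/
inductive Symb : Type
  | bit (b : Bool) | close | item
  | var | const
  | true | eq | not | and | or
  | pref | outcome | user | feature | dom
  deriving DecidableEq, Fintype

/-- A number: its binary digits followed by `close`. -/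
def encNat (n : ℕ) : List Symb := n.bits.map Symb.bit ++ [Symb.close]

/-- An index, written as a number. -/
def encFin {n : ℕ} (i : Fin n) : List Symb := encNat i

/-- A list: each element is preceded by `item`, and the list is closed by `close`. -/
def encList {α : Type} (e : α → List Symb) : List α → List Symb
  | [] => [Symb.close]
  | a :: l => Symb.item :: (e a ++ encList e l)

/-- A tuple, written as the list of its entries. -/
def encTuple {n : ℕ} {α : Type} (e : α → List Symb) (f : Fin n → α) : List Symb :=
  encList e (List.ofFn f)

def encTerm {K : ℕ} : Term K → List Symb
  | .var v => Symb.var :: encNat v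
  | .const c => Symb.const :: encFin c

def encConstraint {K : ℕ} : Constraint K → List Symb
  | .true => [Symb.true]
  | .eq t u => Symb.eq :: (encTerm t ++ encTerm u)
  | .not c => Symb.not :: encConstraint c
  | .and c e => Symb.and :: (encConstraint c ++ encConstraint e)
  | .or c e => Symb.or :: (encConstraint c ++ encConstraint e)

def encHead {N K : ℕ} : Head N (Term K) → List Symb
  | .pref s t => Symb.pref :: (encTuple encTerm s ++ encTuple encTerm t)
  | .outcome s => Symb.outcome :: encTuple encTerm s
  | .user p args => Symb.user :: (encNat p ++ encList encTerm args)

def encAtom {N K : ℕ} : Atom N (Term K) → List Symb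
  | .ofHead h => encHead h
  | .feature i t => Symb.feature :: (encFin i ++ encTerm t)
  | .dom s t => Symb.dom :: (encTuple encTerm s ++ encTuple encTerm t)

def encClause {N K : ℕ} (C : Clause N K) : List Symb :=
  encHead C.head ++ (encConstraint C.constraint ++ encList encAtom C.body)

/-- The word representing an input. -/
def encInput (I : OptInput) : List Symb :=
  encNat I.N ++ (encNat I.K ++ (encTuple (encList encFin) I.theory.values ++
    (encList encClause I.theory.clauses ++ encTuple encFin I.query)))

/-! The words representing inputs determine the inputs. -/

/-- Codes that can be read off from the front of a word in only one way. -/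
def PrefixFree {α : Type} (e : α → List Symb) : Prop :=
  ∀ a b u v, e a ++ u = e b ++ v → a = b ∧ u = v

theorem bits_injective {m n : ℕ} (h : m.bits = n.bits) : m = n := by
  have h' : Nat.digits 2 m = Nat.digits 2 n := by
    rw [Nat.digits_two_eq_bits, Nat.digits_two_eq_bits, h]
  exact Nat.digits_inj_iff.1 h'

theorem prefixFree_encNat : PrefixFree encNat := by
  have key : ∀ (l l' : List Bool) (u v : List Symb),
      l.map Symb.bit ++ (Symb.close :: u) = l'.map Symb.bit ++ (Symb.close :: v) →
      l = l' ∧ u = v := by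
    intro l
    induction l with
    | nil => intro l' u v h; cases l' <;> simp_all
    | cons a l ih =>
      intro l' u v h
      cases l' with
      | nil => simp at h
      | cons b l' =>
        simp only [List.map_cons, List.cons_append, List.cons.injEq, Symb.bit.injEq] at h
        obtain ⟨rfl, rfl⟩ := ih l' u v h.2
        exact ⟨by rw [h.1], rfl⟩
  intro a b u v h
  obtain ⟨h1, h2⟩ := key a.bits b.bits u v (by simpa [encNat] using h)
  exact ⟨bits_injective h1, h2⟩

theorem prefixFree_encFin {n : ℕ} : PrefixFree (encFin (n := n)) := by
  intro a b u v h
  obtain ⟨h1, h2⟩ := prefixFree_encNat _ _ _ _ h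
  exact ⟨Fin.ext h1, h2⟩

theorem prefixFree_encList {α : Type} {e : α → List Symb} (he : PrefixFree e) :
    PrefixFree (encList e) := by
  intro a
  induction a with
  | nil => intro b u v h; cases b <;> simp_all [encList]
  | cons x l ih =>
    intro b u v h
    cases b with
    | nil => simp [encList] at h
    | cons y l' =>
      simp only [encList, List.cons_append, List.append_assoc, List.cons.injEq, _root_.true_and]
        at h
      obtain ⟨rfl, h1⟩ := he _ _ _ _ h
      obtain ⟨rfl, h2⟩ := ih _ _ _ h1
      exact ⟨rfl, h2⟩

theorem prefixFree_encTuple {n : ℕ} {α : Type} {e : α → List Symb} (he : PrefixFree e) :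
    PrefixFree (encTuple (n := n) e) := by
  intro a b u v h
  obtain ⟨h1, h2⟩ := prefixFree_encList he _ _ _ _ h
  exact ⟨List.ofFn_injective h1, h2⟩

theorem prefixFree_encTerm {K : ℕ} : PrefixFree (encTerm (K := K)) := by
  intro a b u v h
  cases a <;> cases b <;>
    simp only [encTerm, List.cons_append, List.cons.injEq, _root_.true_and, reduceCtorEq,
      _root_.false_and] at h
  · obtain ⟨rfl, h2⟩ := prefixFree_encNat _ _ _ _ h
    exact ⟨rfl, h2⟩
  · obtain ⟨rfl, h2⟩ := prefixFree_encFin _ _ _ _ h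
    exact ⟨rfl, h2⟩

theorem prefixFree_encConstraint {K : ℕ} : PrefixFree (encConstraint (K := K)) := by
  intro a
  induction a with
  | true => intro b u v h; cases b <;> simp_all [encConstraint]
  | eq t t' =>
    intro b u v h
    cases b <;> simp [encConstraint] at h
    replace h := prefixFree_encTerm _ _ _ _ h
    obtain ⟨rfl, h⟩ := h
    replace h := prefixFree_encTerm _ _ _ _ h
    obtain ⟨rfl, h⟩ := h
    exact ⟨rfl, h⟩
  | not c ih =>
    intro b u v h
    cases b <;> simp [encConstraint] at h
    replace h := ih _ _ _ h
    obtain ⟨rfl, h⟩ := h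
    exact ⟨rfl, h⟩
  | and c e ih ih' =>
    intro b u v h
    cases b <;> simp [encConstraint] at h
    replace h := ih _ _ _ h
    obtain ⟨rfl, h⟩ := h
    replace h := ih' _ _ _ h
    obtain ⟨rfl, h⟩ := h
    exact ⟨rfl, h⟩
  | or c e ih ih' =>
    intro b u v h
    cases b <;> simp [encConstraint] at h
    replace h := ih _ _ _ h
    obtain ⟨rfl, h⟩ := h
    replace h := ih' _ _ _ h
    obtain ⟨rfl, h⟩ := h
    exact ⟨rfl, h⟩

theorem prefixFree_encHead {N K : ℕ} : PrefixFree (encHead (N := N) (K := K)) := by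
  have ht : PrefixFree (encTuple (n := N) (encTerm (K := K))) :=
    prefixFree_encTuple prefixFree_encTerm
  intro a b u v h
  cases a <;> cases b <;> simp [encHead] at h
  · replace h := ht _ _ _ _ h
    obtain ⟨rfl, h⟩ := h
    replace h := ht _ _ _ _ h
    obtain ⟨rfl, h⟩ := h
    exact ⟨rfl, h⟩
  · replace h := ht _ _ _ _ h
    obtain ⟨rfl, h⟩ := h
    exact ⟨rfl, h⟩
  · replace h := prefixFree_encNat _ _ _ _ h
    obtain ⟨rfl, h⟩ := h
    replace h := prefixFree_encList prefixFree_encTerm _ _ _ _ h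
    obtain ⟨rfl, h⟩ := h
    exact ⟨rfl, h⟩

theorem prefixFree_encAtom {N K : ℕ} : PrefixFree (encAtom (N := N) (K := K)) := by
  have ht : PrefixFree (encTuple (n := N) (encTerm (K := K))) :=
    prefixFree_encTuple prefixFree_encTerm
  intro a b u v h
  cases a with
  | ofHead p =>
    cases b with
    | ofHead q =>
      replace h := prefixFree_encHead _ _ _ _ h
      obtain ⟨rfl, h⟩ := h
      exact ⟨rfl, h⟩
    | feature i t => cases p <;> simp [encAtom, encHead] at h
    | dom s t => cases p <;> simp [encAtom, encHead] at h
  | feature i t =>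
    cases b with
    | ofHead q => cases q <;> simp [encAtom, encHead] at h
    | feature j t' =>
      simp [encAtom] at h
      replace h := prefixFree_encFin _ _ _ _ h
      obtain ⟨rfl, h⟩ := h
      replace h := prefixFree_encTerm _ _ _ _ h
      obtain ⟨rfl, h⟩ := h
      exact ⟨rfl, h⟩
    | dom s t => simp [encAtom] at h
  | dom s t =>
    cases b with
    | ofHead q => cases q <;> simp [encAtom, encHead] at h
    | feature j t' => simp [encAtom] at h
    | dom s' t' =>
      simp [encAtom] at h
      replace h := ht _ _ _ _ h
      obtain ⟨rfl, h⟩ := h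
      replace h := ht _ _ _ _ h
      obtain ⟨rfl, h⟩ := h
      exact ⟨rfl, h⟩

theorem prefixFree_encClause {N K : ℕ} : PrefixFree (encClause (N := N) (K := K)) := by
  rintro ⟨h1, c1, b1⟩ ⟨h2, c2, b2⟩ u v h
  simp only [encClause, List.append_assoc] at h
  replace h := prefixFree_encHead _ _ _ _ h
  obtain ⟨rfl, h⟩ := h
  replace h := prefixFree_encConstraint _ _ _ _ h
  obtain ⟨rfl, h⟩ := h
  replace h := prefixFree_encList prefixFree_encAtom _ _ _ _ h
  obtain ⟨rfl, h⟩ := h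
  exact ⟨rfl, h⟩

theorem encInput_injective : Function.Injective encInput := by
  rintro ⟨N, K, ⟨pos, vals, cls⟩, q⟩ ⟨N', K', ⟨pos', vals', cls'⟩, q'⟩ h
  simp only [encInput] at h
  replace h := prefixFree_encNat _ _ _ _ h
  obtain ⟨rfl, h⟩ := h
  replace h := prefixFree_encNat _ _ _ _ h
  obtain ⟨rfl, h⟩ := h
  replace h := prefixFree_encTuple (prefixFree_encList prefixFree_encFin) _ _ _ _ h
  obtain ⟨rfl, h⟩ := h
  replace h := prefixFree_encList prefixFree_encClause _ _ _ _ h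
  obtain ⟨rfl, h⟩ := h
  obtain ⟨rfl, -⟩ := prefixFree_encTuple prefixFree_encFin q q' [] [] (by simpa using h)
  rfl

/-- The encoding of inputs of the optimality problem as words over `Symb`. -/
noncomputable def inputEncoding : Computability.Encoding OptInput Symb where
  encode := encInput
  decode := Function.partialInv encInput
  decode_encode := Function.partialInv_left encInput_injective

end LCP

/-- The decision problem `L`, on inputs written as words over a finite alphabet, is in EXPTIME:
some deterministic multi-stack Turing machine decides it, and on inputs of length `n` halts with
its answer within `2 ^ p(n)` steps, for a fixed polynomial `p`. -/
def InEXPTIME {α Γ : Type} [Fintype Γ] (e : Computability.Encoding α Γ) (L : α → Prop) : Prop :=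
  ∃ f : α → Bool, (∀ a, f a = true ↔ L a) ∧
    ∃ M : Turing.TM2ComputableInTime e.encode Computability.encodeBool f,
      (∀ k, Finite (M.tm.Γ k)) ∧ ∃ p : Polynomial ℕ, ∀ n, M.time n ≤ 2 ^ p.eval n

/-! Grounding turns the theory into a propositional Horn program of exponential size. For an input
word of length `n` there are at most `2 ^ n` constants, since their number is written in binary, at
most `n` features, and at most `n + 1` candidate names of variables. Hence there are at most `2 ^ (n
* (n + 1))` assignments to the variables, and no more than that many tuples. The instances of the
clauses, the domain facts and the runtime clauses for dominance form a list of ground rules whose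
length is polynomial in this number. Iterating the immediate consequences of `m` ground rules from
the empty set stabilises within `m + 1` rounds (`hornStep_hornClosure`); optimality is then checked
by running through all tuples. Correctness is `decideOptimal_iff`, which rests on the two
translations `derivable_of_entails` and `entails_of_derivable`.

The running time is obtained by padding. `exists_pad` appends the unary number `2 ^ (n * (n + 1))`
to the word in exponential time; relative to the padded size the whole procedure is polynomial
(`ptime_decideOptimal`), and a polynomial of an exponentially bounded quantity is exponentially
bounded (`ExpBdd.eval`). Everything but the padding and the input and output conversions thus stays
inside the class `PTime` of functions on tree-encoded data, which is closed under composition,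
pairing, case distinction, and iteration or folding with bounded intermediate results. Each such
function carries a structured stack program, and `Exec.evalsTo` shows that the compiled stack
machine follows the program.

No syntax tree is built. Prefix notation read from right to left is a program for an evaluation
stack, so one pass over the word under a given assignment yields the ground instances directly
(`read_encInput`). -/

open Turing StateTransition

/-! ### Structured programs over stacks, and their compilation to stack machines -/

namespace StackProg

/-- Structured programs that operate on stacks indexed by `K` and a register in `σ`. -/
inductive Prog {K : Type} (Γ : K → Type) (σ : Type) : Type
  | push (k : K) (f : σ → Γ k)
  | pop (k : K) (f : σ → Option (Γ k) → σ)
  | seq (p q : Prog Γ σ)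
  | ite (c : σ → Bool) (p q : Prog Γ σ)
  | loop (c : σ → Bool) (p : Prog Γ σ)

namespace Prog

variable {K : Type} {Γ : K → Type} {σ : Type}

/-- The control points of a program. -/
def Lab : Prog Γ σ → Type
  | push _ _ => Unit
  | pop _ _ => Unit
  | seq p q => p.Lab ⊕ q.Lab
  | ite _ p q => Option (p.Lab ⊕ q.Lab)
  | loop _ p => Option p.Lab

/-- A program has finitely many control points. -/
@[reducible]
noncomputable def labFintype : (p : Prog Γ σ) → Fintype p.Lab
  | push _ _ => inferInstanceAs (Fintype Unit)
  | pop _ _ => inferInstanceAs (Fintype Unit)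
  | seq p q =>
    letI := p.labFintype
    letI := q.labFintype
    inferInstanceAs (Fintype (p.Lab ⊕ q.Lab))
  | ite _ p q =>
    letI := p.labFintype
    letI := q.labFintype
    inferInstanceAs (Fintype (Option (p.Lab ⊕ q.Lab)))
  | loop _ p =>
    letI := p.labFintype
    inferInstanceAs (Fintype (Option p.Lab))

/-- The control point at which execution starts. -/
def entry : (p : Prog Γ σ) → p.Lab
  | push _ _ => ()
  | pop _ _ => ()
  | seq p _ => Sum.inl p.entry
  | ite _ _ _ => none
  | loop _ _ => none

/-- The machine statement at a control point of a program, where `ι` places the control points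
of the program among the labels of a machine, and `e` is the label at which the program exits. -/
def emit {Λ : Type} : (p : Prog Γ σ) → (p.Lab → Λ) → Λ → p.Lab → TM2.Stmt Γ Λ σ
  | push k f, _, e, _ => .push k f (.goto fun _ => e)
  | pop k f, _, e, _ => .pop k f (.goto fun _ => e)
  | seq p q, ι, e, l =>
    Sum.elim (p.emit (fun l => ι (Sum.inl l)) (ι (Sum.inr q.entry)))
      (q.emit (fun l => ι (Sum.inr l)) e) l
  | ite c p q, ι, e, l =>
    Option.elim l
      (.branch c (.goto fun _ => ι (some (Sum.inl p.entry)))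
        (.goto fun _ => ι (some (Sum.inr q.entry))))
      (Sum.elim (p.emit (fun l => ι (some (Sum.inl l))) e)
        (q.emit (fun l => ι (some (Sum.inr l))) e))
  | loop c p, ι, e, l =>
    Option.elim l
      (.branch c (.goto fun _ => ι (some p.entry)) (.goto fun _ => e))
      (p.emit (fun l => ι (some l)) (ι none))

variable [DecidableEq K]

/-- `Exec p v S v' S' t`: started with register `v` and stacks `S`, the program `p` terminates with
register `v'` and stacks `S'` within time `t`. -/
inductive Exec : Prog Γ σ → σ → (∀ k, List (Γ k)) → σ → (∀ k, List (Γ k)) → ℕ → Prop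
  | push {k f v S} : Exec (.push k f) v S v (Function.update S k (f v :: S k)) 1
  | pop {k f v S} : Exec (.pop k f) v S (f v (S k).head?) (Function.update S k (S k).tail) 1
  | seq {p q v S v' S' v'' S'' t t'} : Exec p v S v' S' t → Exec q v' S' v'' S'' t' →
      Exec (.seq p q) v S v'' S'' (t + t')
  | ite_true {c p q v S v' S' t} : c v = true → Exec p v S v' S' t →
      Exec (.ite c p q) v S v' S' (t + 1)
  | ite_false {c p q v S v' S' t} : c v = false → Exec q v S v' S' t →
      Exec (.ite c p q) v S v' S' (t + 1)
  | loop_false {c p v S} : c v = false → Exec (.loop c p) v S v S 1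
  | loop_true {c p v S v' S' v'' S'' t t'} : c v = true → Exec p v S v' S' t →
      Exec (.loop c p) v' S' v'' S'' t' → Exec (.loop c p) v S v'' S'' (t + t' + 1)
  -- This makes the time an upper bound, so that estimates can be rounded up at any point.
  | mono {p v S v' S' t t'} : Exec p v S v' S' t → t ≤ t' → Exec p v S v' S' t'

/-- A machine that contains the statements of a program follows the execution of the program. -/
theorem Exec.evalsTo {p : Prog Γ σ} {v v' : σ} {S S' : ∀ k, List (Γ k)} {t : ℕ}
    (h : p.Exec v S v' S' t) : ∀ {Λ : Type} (m : Λ → TM2.Stmt Γ Λ σ) (ι : p.Lab → Λ) (e : Λ),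
      (∀ l, m (ι l) = p.emit ι e l) →
      Nonempty (EvalsToInTime (TM2.step m) ⟨some (ι p.entry), v, S⟩ (some ⟨some e, v', S'⟩) t) := by
  induction h with
  | push => exact fun m ι e hm => ⟨⟨⟨1, by simp [flip, hm, emit]⟩, le_rfl⟩⟩
  | pop => exact fun m ι e hm => ⟨⟨⟨1, by simp [flip, hm, emit]⟩, le_rfl⟩⟩
  | @seq p q v S v' S' v'' S'' t t' _ _ ih₁ ih₂ =>
    intro Λ m ι e hm
    obtain ⟨e₁⟩ := ih₁ m (fun l => ι (Sum.inl l)) (ι (Sum.inr q.entry)) fun l => hm (Sum.inl l)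
    obtain ⟨e₂⟩ := ih₂ m (fun l => ι (Sum.inr l)) e fun l => hm (Sum.inr l)
    -- `EvalsToInTime.trans` puts the time of the second run first.
    rw [add_comm]
    exact ⟨EvalsToInTime.trans _ _ _ _ _ _ e₁ e₂⟩
  | @ite_true c p q v S v' S' t hc _ ih =>
    intro Λ m ι e hm
    obtain ⟨e₁⟩ := ih m (fun l => ι (some (Sum.inl l))) e fun l => hm (some (Sum.inl l))
    refine ⟨EvalsToInTime.trans _ 1 _ _ _ _ ⟨⟨1, ?_⟩, le_rfl⟩ e₁⟩
    have h : m (ι none) = .branch c (.goto fun _ => ι (some (Sum.inl p.entry)))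
        (.goto fun _ => ι (some (Sum.inr q.entry))) := hm none
    simp [flip, entry, h, hc]
  | @ite_false c p q v S v' S' t hc _ ih =>
    intro Λ m ι e hm
    obtain ⟨e₁⟩ := ih m (fun l => ι (some (Sum.inr l))) e fun l => hm (some (Sum.inr l))
    refine ⟨EvalsToInTime.trans _ 1 _ _ _ _ ⟨⟨1, ?_⟩, le_rfl⟩ e₁⟩
    have h : m (ι none) = .branch c (.goto fun _ => ι (some (Sum.inl p.entry)))
        (.goto fun _ => ι (some (Sum.inr q.entry))) := hm none
    simp [flip, entry, h, hc]
  | @loop_false c p v S hc =>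
    intro Λ m ι e hm
    have h : m (ι none) = .branch c (.goto fun _ => ι (some p.entry)) (.goto fun _ => e) := hm none
    exact ⟨⟨⟨1, by simp [flip, entry, h, hc]⟩, le_rfl⟩⟩
  | @loop_true c p v S v' S' v'' S'' t t' hc _ _ ih₁ ih₂ =>
    intro Λ m ι e hm
    obtain ⟨e₁⟩ := ih₁ m (fun l => ι (some l)) (ι none) fun l => hm (some l)
    obtain ⟨e₂⟩ := ih₂ m ι e hm
    refine ⟨EvalsToInTime.trans _ 1 _ _ _ _ ⟨⟨1, ?_⟩, le_rfl⟩
      (add_comm t' t ▸ EvalsToInTime.trans _ _ _ _ _ _ e₁ e₂)⟩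
    have h : m (ι none) = .branch c (.goto fun _ => ι (some p.entry)) (.goto fun _ => e) := hm none
    simp [flip, entry, h, hc]
  | mono _ htt ih =>
    intro Λ m ι e hm
    obtain ⟨e₁⟩ := ih m ι e hm
    exact ⟨⟨e₁.toEvalsTo, e₁.steps_le_m.trans htt⟩⟩

/-- A program lengthens a stack by at most one entry per unit of time. -/
theorem Exec.length_le {p : Prog Γ σ} {v v' : σ} {S S' : ∀ k, List (Γ k)} {t : ℕ}
    (h : p.Exec v S v' S' t) (k : K) : (S' k).length ≤ (S k).length + t := by
  induction h with
  | @push k' => by_cases hk : k = k' <;> [subst hk; skip] <;> simp [Function.update, *]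
  | @pop k' =>
    by_cases hk : k = k' <;> [subst hk; skip] <;> simp [Function.update, *]
    omega
  | _ => omega

end Prog

end StackProg

/-! ### Programs that operate on trees -/

/-- Binary trees. -/
inductive Tr : Type
  | leaf
  | node (x y : Tr)
  deriving DecidableEq

namespace Tr

/-- A tree, written in prefix notation. -/
def code : Tr → List Bool
  | leaf => [false]
  | node x y => true :: (x.code ++ y.code)

/-- The number of nodes and leaves of a tree. -/
def size : Tr → ℕ
  | leaf => 1
  | node x y => x.size + y.size + 1

/-- The length of the right spine of a tree. -/
def spine : Tr → ℕ
  | leaf => 0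
  | node _ y => y.spine + 1

@[simp] theorem length_code : (x : Tr) → x.code.length = x.size
  | leaf => rfl
  | node x y => by simp [code, size, length_code x, length_code y]

theorem size_pos (x : Tr) : 0 < x.size := by cases x <;> simp [size]

theorem spine_lt_size : (x : Tr) → x.spine < x.size
  | leaf => Nat.one_pos
  | node x y => by
    have := spine_lt_size y
    simp only [spine, size]
    omega

end Tr

namespace StackProg

/-! ### Elementary stack programs and their running times. -/

/-- The working stacks. -/
inductive Wk : Type
  | m | a | b | c
  deriving DecidableEq

instance : Fintype Wk := ⟨{.m, .a, .b, .c}, fun k => by cases k <;> decide⟩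

/-- The alphabets: the stack `none` holds the input, the working stacks hold bits. -/
abbrev Cells (A : Type) : Option Wk → Type
  | none => A
  | some _ => Bool

/-- The register holds the symbol that was read last. -/
abbrev Rg (A : Type) : Type := Option (A ⊕ Bool)

/-- Programs with input alphabet `A`. -/
abbrev Pr (A : Type) : Type := Prog (Cells A) (Rg A)

section

variable {A : Type}

/-- The stacks with the given contents. -/
def st (i : List A) (m a b c : List Bool) : ∀ k, List (Cells A k)
  | none => i
  | some .m => m
  | some .a => a
  | some .b => b
  | some .c => c

section
variable (i : List A) (m a b c : List Bool) (x : List Bool)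
@[simp] theorem st_none : st i m a b c none = i := rfl
@[simp] theorem st_m : st i m a b c (some .m) = m := rfl
@[simp] theorem st_a : st i m a b c (some .a) = a := rfl
@[simp] theorem st_b : st i m a b c (some .b) = b := rfl
@[simp] theorem st_c : st i m a b c (some .c) = c := rfl
@[simp] theorem update_st_none (j : List A) :
    Function.update (st i m a b c) none j = st j m a b c := by
  funext k; rcases k with _ | _ | _ | _ | _ <;> rfl
@[simp] theorem update_st_m : Function.update (st i m a b c) (some .m) x = st i x a b c := by
  funext k; rcases k with _ | _ | _ | _ | _ <;> rfl
@[simp] theorem update_st_a : Function.update (st i m a b c) (some .a) x = st i m x b c := by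
  funext k; rcases k with _ | _ | _ | _ | _ <;> rfl
@[simp] theorem update_st_b : Function.update (st i m a b c) (some .b) x = st i m a x c := by
  funext k; rcases k with _ | _ | _ | _ | _ <;> rfl
@[simp] theorem update_st_c : Function.update (st i m a b c) (some .c) x = st i m a b x := by
  funext k; rcases k with _ | _ | _ | _ | _ <;> rfl
end

/-- The bit in the register. -/
def bit : Rg A → Bool
  | some (.inr b) => b
  | _ => false

@[simp] theorem bit_inr (b : Bool) : bit (some (.inr b) : Rg A) = b := rfl

/-- Pop a bit into the register. -/
def pull (k : Wk) : Pr A := .pop (some k) fun _ o => o.map Sum.inr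

/-- Push the bit in the register. -/
def put (k : Wk) : Pr A := .push (some k) bit

/-- Push a fixed bit. -/
def lit (k : Wk) (b : Bool) : Pr A := .push (some k) fun _ => b

/-- Pop a bit and clear the register. -/
def skim (k : Wk) : Pr A := .pop (some k) fun _ _ => none

/-- Pop all bits from a stack and push them on another one. -/
def move (k k' : Wk) : Pr A :=
  .seq (pull k) (.loop Option.isSome (.seq (put k') (pull k)))

/-- Empty a stack. -/
def clear (k : Wk) : Pr A := .seq (pull k) (.loop Option.isSome (pull k))

/-- Move the tree on top of stack `m` to stack `a`. -/
def readTree : Pr A :=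
  .seq (lit .c true) <| .seq (pull .c) <| .loop bit <|
    .seq (pull .m) <| .seq (put .a) <| .ite bit (lit .c true) (pull .c)

/-- Move the bits on stack `a` to both `m` and `b`. -/
def fork : Pr A :=
  .seq (pull .a) (.loop Option.isSome (.seq (put .m) (.seq (put .b) (pull .a))))

section
open Prog
variable {i : List A} {m a b c : List Bool} {v : Rg A}

/-- The form in which executions are used: composing the rules produces a raw time and raw final
stacks, which are compared with the intended ones afterwards. -/
theorem Exec.to {p : Pr A} {v v' : Rg A} {S S' S'' : ∀ k, List (Cells A k)} {t t' : ℕ}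
    (h : Exec p v S v' S' t) (ht : t ≤ t') (hS : S' = S'') : Exec p v S v' S'' t' :=
  hS ▸ h.mono ht

theorem exec_pull {k : Wk} {S : ∀ k, List (Cells A k)} :
    Exec (pull k) v S ((S (some k)).head?.map Sum.inr)
      (Function.update S (some k) (S (some k)).tail) 1 := Exec.pop

theorem exec_put {k : Wk} {S : ∀ k, List (Cells A k)} :
    Exec (put k) v S v (Function.update S (some k) (bit v :: S (some k))) 1 := Exec.push

theorem exec_lit {k : Wk} {x : Bool} {S : ∀ k, List (Cells A k)} :
    Exec (lit k x) v S v (Function.update S (some k) (x :: S (some k))) 1 := Exec.push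

theorem exec_skim {k : Wk} {S : ∀ k, List (Cells A k)} :
    Exec (skim k) v S none (Function.update S (some k) (S (some k)).tail) 1 := Exec.pop

theorem exec_move {k k' : Wk} (hk : k ≠ k') (S : ∀ k, List (Cells A k)) :
    Exec (move k k') v S none (Function.update (Function.update S (some k) []) (some k')
      ((S (some k)).reverse ++ S (some k'))) (3 * (S (some k)).length + 2) := by
  -- Loop invariant: of the list `l` still to be moved, the head is already in the register and only
  -- the tail is on the stack, because the loop tests the register after a pop.
  have key : ∀ (l : List Bool) (S : ∀ k, List (Cells A k)), S (some k) = l.tail →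
      Exec (.loop Option.isSome (.seq (put k') (pull k))) (l.head?.map Sum.inr) S none
        (Function.update (Function.update S (some k) []) (some k')
          (l.reverse ++ S (some k'))) (3 * l.length + 1) := by
    intro l
    induction l with
    | nil =>
      intro S hS
      have h1 : Function.update S (some k) [] = S := by
        rw [← Function.update_eq_self (some k) S, hS]; simp
      rw [h1]
      simpa using Exec.loop_false (p := .seq (put k') (pull k)) (S := S) rfl
    | cons x l ih =>
      intro S hS
      have h2 := exec_pull (v := some (.inr x)) (k := k)
        (S := Function.update S (some k') (x :: S (some k')))
      have h3 := ih _ (show (Function.update (Function.update S (some k') (x :: S (some k')))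
        (some k) l.tail) (some k) = l.tail by simp)
      rw [Function.update_of_ne (by simpa using hk), hS] at h2
      refine Exec.to (Exec.loop_true rfl (Exec.seq exec_put h2) h3) ?_ ?_
      · simp; omega
      · funext j
        by_cases h1 : j = some k'
        · subst h1; simp [Function.update_of_ne (show some k' ≠ some k by simpa using hk.symm)]
        · by_cases h4 : j = some k
          · subst h4; simp [Function.update_of_ne h1]
          · simp [Function.update_of_ne h1, Function.update_of_ne h4]
  have h := key (S (some k)) (Function.update S (some k) (S (some k)).tail) (by simp)
  refine Exec.to (Exec.seq exec_pull h) (by omega) ?_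
  simp [Function.update_of_ne (show some k' ≠ some k by simpa using hk.symm)]

theorem exec_clear {k : Wk} (S : ∀ k, List (Cells A k)) :
    Exec (clear k) v S none (Function.update S (some k) []) (2 * (S (some k)).length + 2) := by
  have key : ∀ (l : List Bool) (S : ∀ k, List (Cells A k)), S (some k) = l.tail →
      Exec (.loop Option.isSome (pull k)) (l.head?.map Sum.inr) S none
        (Function.update S (some k) []) (2 * l.length + 1) := by
    intro l
    induction l with
    | nil =>
      intro S hS
      have h1 : Function.update S (some k) [] = S := by
        rw [← Function.update_eq_self (some k) S, hS]; simp
      rw [h1]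
      simpa using Exec.loop_false (p := pull k) (S := S) rfl
    | cons x l ih =>
      intro S hS
      have h2 := exec_pull (v := some (.inr x)) (k := k) (S := S)
      rw [hS] at h2
      have h3 := ih _ (show (Function.update S (some k) l.tail) (some k) = l.tail by simp)
      refine Exec.to (Exec.loop_true rfl h2 h3) ?_ ?_
      · simp; omega
      · simp
  have h := key (S (some k)) (Function.update S (some k) (S (some k)).tail) (by simp)
  refine Exec.to (Exec.seq exec_pull h) (by omega) ?_
  simp

theorem exec_fork {l : List Bool} : Exec fork v (st i m l b c) none
    (st i (l.reverse ++ m) [] (l.reverse ++ b) c) (4 * l.length + 2) := by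
  have key : ∀ (l m b : List Bool),
      Exec (.loop Option.isSome (.seq (put .m) (.seq (put .b) (pull .a)))) (l.head?.map Sum.inr)
        (st i m l.tail b c) none
        (st i (l.reverse ++ m) [] (l.reverse ++ b) c) (4 * l.length + 1) := by
    intro l
    induction l with
    | nil => intro m b; simpa using Exec.loop_false rfl
    | cons x l ih =>
      intro m b
      refine Exec.to (Exec.loop_true rfl (Exec.seq exec_put (Exec.seq exec_put exec_pull))
        (by simpa using ih (x :: m) (x :: b))) ?_ ?_
      · simp; omega
      · simp
  refine Exec.to (Exec.seq exec_pull (by simpa using key l m b)) (by omega) rfl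

/-- Stack `c` counts in unary the subtrees that remain after the current one. A node adds one to the
count, since two subtrees replace one; a leaf removes one. When `c` is empty the pop leaves the
register empty and the loop ends. The initial push and pop on `c` only set the register to `true`.
-/
theorem exec_readTree (x : Tr) (r : List Bool) : Exec readTree v (st i (x.code ++ r) a b []) none
    (st i r (x.code.reverse ++ a) b []) (5 * x.size + 3) := by
  -- Stated with a continuation: any run of the loop from the state after `x` extends to one from
  -- the state before `x`. The induction on `x` then chains the two subtrees.
  have key : ∀ (x : Tr) (r a c : List Bool) (w : Rg A) (S : ∀ k, List (Cells A k)) (t : ℕ),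
      Exec (.loop bit (.seq (pull .m) <| .seq (put .a) <| .ite bit (lit .c true) (pull .c)))
        (c.head?.map Sum.inr) (st i r (x.code.reverse ++ a) b c.tail) w S t →
      Exec (.loop bit (.seq (pull .m) <| .seq (put .a) <| .ite bit (lit .c true) (pull .c)))
        (some (.inr true)) (st i (x.code ++ r) a b c) w S (5 * x.size + t) := by
    intro x
    induction x with
    | leaf =>
      intro r a c w S t h
      refine Exec.to (Exec.loop_true rfl (Exec.seq exec_pull (Exec.seq exec_put
        (Exec.ite_false rfl exec_pull))) (by simpa [Tr.code] using h)) ?_ rfl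
      simp only [Tr.size]; omega
    | node x y ihx ihy =>
      intro r a c w S t h
      have h1 := ihx (y.code ++ r) (true :: a) (true :: c) w S _
        (ihy r (x.code.reverse ++ true :: a) c w S t (by simpa [Tr.code] using h))
      refine Exec.to (Exec.loop_true rfl (Exec.seq exec_pull (Exec.seq exec_put
        (Exec.ite_true rfl exec_lit))) (by simpa [Tr.code] using h1)) ?_ rfl
      simp [Tr.size]; omega
  have h := key x r a [] none _ 1 (Exec.loop_false rfl)
  refine Exec.to (Exec.seq exec_lit (Exec.seq exec_pull (by simpa using h))) (by omega) rfl

theorem exec_pull_code (x : Tr) (r : List Bool) :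
    Exec (pull .m) v (st i (x.code ++ r) a b c) (some (.inr x.code.head!))
      (st i (x.code.tail ++ r) a b c) 1 := by
  cases x
  · simpa [Tr.code] using exec_pull (v := v) (k := .m) (S := st i (Tr.leaf.code ++ r) a b c)
  · next x y =>
    simpa [Tr.code] using exec_pull (v := v) (k := .m) (S := st i ((Tr.node x y).code ++ r) a b c)

/-! ### Programs as transformations of the tree on top of the main stack. -/

/-- `Does p x y t`: the program `p` turns the tree `x` into the tree `y` within time `t`. -/
def Does (p : Pr A) (x y : Tr) (t : ℕ) : Prop :=
  -- The untouched rest `r` lets a program run on the first component of a pair while the second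
  -- lies below it.
  ∀ (i : List A) (r : List Bool),
    Exec p none (st i (x.code ++ r) [] [] []) none (st i (y.code ++ r) [] [] []) t

theorem Does.mono {p : Pr A} {x y : Tr} {t t' : ℕ} (h : Does p x y t) (ht : t ≤ t') :
    Does p x y t' := fun i r => (h i r).mono ht

theorem Does.size_le {p : Pr A} {x y : Tr} {t : ℕ} (h : Does p x y t) : y.size ≤ x.size + t := by
  simpa using (h [] []).length_le (some .m)

theorem Does.seq {p q : Pr A} {x y z : Tr} {t t' : ℕ} (h : Does p x y t) (h' : Does q y z t') :
    Does (.seq p q) x z (t + t') := fun i r => (h i r).seq (h' i r)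

/-- Exchange the two trees on top of stack `m`. -/
def swapTop : Pr A :=
  .seq readTree <| .seq (move .a .b) <| .seq readTree <| .seq (move .b .c) <|
    .seq (move .c .m) (move .a .m)

/-- Reading a tree reverses its code and needs `c` empty. The first tree is therefore parked on `b`
while the second is read, and passes through `c` so that it returns to `m` in the right orientation.
-/
theorem exec_swapTop (x y : Tr) (r : List Bool) :
    Exec swapTop v (st i (x.code ++ (y.code ++ r)) [] [] []) none
      (st i (y.code ++ (x.code ++ r)) [] [] []) (20 * (x.size + y.size) + 20) := by
  refine Exec.to (Exec.seq (exec_readTree x _) <| Exec.seq (exec_move (by decide) _) <|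
    Exec.seq (by simpa using exec_readTree y _) <| Exec.seq (exec_move (by decide) _) <|
    Exec.seq (exec_move (by decide) _) (exec_move (by decide) _)) ?_ ?_
  · simp; omega
  · simp

/-- Drop the tree on top of stack `m`. -/
def dropTop : Pr A := .seq readTree (clear .a)

theorem exec_dropTop (x : Tr) (r : List Bool) :
    Exec dropTop v (st i (x.code ++ r) [] [] []) none (st i r [] [] []) (7 * x.size + 7) := by
  refine Exec.to (Exec.seq (exec_readTree x _) (exec_clear _)) ?_ ?_
  · simp; omega
  · simp

/-- `x ↦ node x x`. -/
def opDup : Pr A :=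
  .seq readTree <| .seq fork <| .seq (move .b .a) <| .seq (move .a .m) (lit .m true)

theorem does_opDup (x : Tr) : Does (A := A) opDup x (.node x x) (20 * x.size + 20) := by
  intro i r
  refine Exec.to (Exec.seq (exec_readTree x _) <| Exec.seq exec_fork <|
    Exec.seq (exec_move (by decide) _) <|
    Exec.seq (exec_move (by decide) _) exec_lit) ?_ ?_
  · simp; omega
  · simp [Tr.code]

/-- `node x y ↦ node y x`. -/
def opSwap : Pr A := .seq (skim .m) (.seq swapTop (lit .m true))

theorem does_opSwap (x y : Tr) :
    Does (A := A) opSwap (.node x y) (.node y x) (20 * (x.size + y.size) + 22) := by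
  intro i r
  refine Exec.to (Exec.seq exec_skim <| Exec.seq (by simpa [Tr.code] using exec_swapTop x y r)
    exec_lit) ?_ ?_
  · omega
  · simp [Tr.code]

/-- `node x y ↦ y`. -/
def opSnd : Pr A := .seq (skim .m) dropTop

theorem does_opSnd (x y : Tr) : Does (A := A) opSnd (.node x y) y (7 * x.size + 8) := by
  intro i r
  refine Exec.to (Exec.seq exec_skim
    (by simpa [Tr.code] using exec_dropTop x (y.code ++ r))) (by omega) rfl

/-- `x ↦ leaf`. -/
def opLeaf : Pr A := .seq dropTop (lit .m false)

theorem does_opLeaf (x : Tr) : Does (A := A) opLeaf x .leaf (7 * x.size + 8) := by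
  intro i r
  refine Exec.to (Exec.seq (exec_dropTop x r) exec_lit) (by omega) ?_
  simp [Tr.code]

/-- `node x y ↦ node (p x) y`. -/
def opFirst (p : Pr A) : Pr A := .seq (skim .m) (.seq p (lit .m true))

theorem Does.opFirst {p : Pr A} {x x' : Tr} {t : ℕ} (h : Does p x x' t) (y : Tr) :
    Does (opFirst p) (.node x y) (.node x' y) (t + 2) := by
  intro i r
  refine Exec.to (Exec.seq exec_skim <| Exec.seq (by simpa [Tr.code] using h i (y.code ++ r))
    exec_lit) (by omega) ?_
  simp [Tr.code]

/-- Remove the first component; run `p` if it was a node and `q` if it was the leaf. -/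
def opBranch (p q : Pr A) : Pr A :=
  .seq (skim .m) <| .seq (pull .m) <| .ite bit (.seq (lit .m true) (.seq dropTop p))
    -- Stack `c` is empty here; the pop serves only to clear the register.
    (.seq (skim .c) q)

theorem Does.opBranch_node {p : Pr A} {y z : Tr} {t : ℕ} (h : Does p y z t) (q : Pr A)
    (u w : Tr) : Does (opBranch p q) (.node (.node u w) y) z (7 * (u.size + w.size) + t + 20) := by
  intro i r
  refine Exec.to (Exec.seq exec_skim <| Exec.seq exec_pull <| Exec.ite_true rfl <|
    Exec.seq exec_lit <| Exec.seq (by simpa [Tr.code] using exec_dropTop (.node u w) (y.code ++ r))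
    (h i r)) ?_ rfl
  simp only [Tr.size]
  omega

theorem Does.opBranch_leaf {q : Pr A} {y z : Tr} {t : ℕ} (p : Pr A) (h : Does q y z t) :
    Does (opBranch p q) (.node .leaf y) z (t + 20) := by
  intro i r
  exact Exec.to (Exec.seq exec_skim <| Exec.seq exec_pull <| Exec.ite_false rfl <|
    Exec.seq exec_skim <| (by simpa [Tr.code] using h i r)) (by omega) rfl

/-- Turn a tree into the list of the bits of its code, where the bit `b` is represented by the
tree `leaf` or `node leaf leaf`. -/
def opCode : Pr A :=
  .seq readTree <| .seq (lit .m false) <| .seq (pull .a) <| .loop Option.isSome <|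
    -- `put .c` stands for doing nothing: the bit it pushes is discarded by the later `skim .c`,
    -- which in the other branch pops an empty stack.
    .seq (lit .m false) <| .seq (.ite bit (.seq (lit .m false) (lit .m true)) (put .c)) <|
    .seq (lit .m true) <| .seq (skim .c) (pull .a)

/-- The list of the bits in `l`, as a tree. -/
def bitsTr : List Bool → Tr
  | [] => .leaf
  | b :: l => .node (cond b (.node .leaf .leaf) .leaf) (bitsTr l)

theorem does_opCode (x : Tr) : Does (A := A) opCode x (bitsTr x.code) (20 * x.size + 20) := by
  intro i r
  have key : ∀ (l l' : List Bool), Exec (.loop (Γ := Cells A) Option.isSome <|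
      .seq (lit .m false) <| .seq (.ite bit (.seq (lit .m false) (lit .m true)) (put .c)) <|
      .seq (lit .m true) <| .seq (skim .c) (pull .a)) (l.head?.map Sum.inr)
      (st i ((bitsTr l').code ++ r) l.tail [] []) none
      (st i ((bitsTr (l.reverse ++ l')).code ++ r) [] [] []) (10 * l.length + 1) := by
    intro l
    induction l with
    | nil => intro l'; simpa using Exec.loop_false rfl
    | cons b l ih =>
      intro l'
      have h := ih (b :: l')
      cases b
      · refine Exec.to (Exec.loop_true rfl (Exec.seq exec_lit <| Exec.seq (Exec.ite_false rfl
          exec_put) <| Exec.seq exec_lit <| Exec.seq exec_skim exec_pull)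
          (by simpa [bitsTr, Tr.code] using h)) ?_ ?_
        · simp; omega
        · simp
      · refine Exec.to (Exec.loop_true rfl (Exec.seq exec_lit <| Exec.seq (Exec.ite_true rfl
          (Exec.seq exec_lit exec_lit)) <| Exec.seq exec_lit <| Exec.seq exec_skim exec_pull)
          (by simpa [bitsTr, Tr.code] using h)) ?_ ?_
        · simp; omega
        · simp
  refine Exec.to (Exec.seq (exec_readTree x r) <| Exec.seq exec_lit <| Exec.seq exec_pull
    (by simpa [bitsTr, Tr.code] using key x.code.reverse [])) ?_ ?_
  · omega
  · simp

/-- `node c s ↦ p (… (p s))`, as often as the spine of `c` is long. -/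
def opIter (p : Pr A) : Pr A :=
  .seq (skim .m) <| .seq (pull .m) <| .seq (.loop bit (.seq dropTop <| .seq swapTop <| .seq p <|
    .seq swapTop (pull .m))) (skim .c)

/-- The counter tree lies above the state. Each round strips one node of its spine, exchanges
counter and state, runs `p` and exchanges back. Dropping a component costs `7` and the two exchanges
`20` each per unit of counter size, whence `47`; the exchanges also handle two states of size at
most `B`, whence `40 * B`. -/
theorem does_opIter {p : Pr A} (n : Tr) (s : ℕ → Tr) {t B : ℕ}
    (h : ∀ j < n.spine, Does p (s j) (s (j + 1)) t) (hB : ∀ j ≤ n.spine, (s j).size ≤ B) :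
    Does (opIter p) (.node n (s 0)) (s n.spine)
      (n.size * (t + 47 * n.size + 40 * B + 60)) := by
  have key : ∀ (n : Tr) (s : ℕ → Tr) (i : List A) (r : List Bool),
      (∀ j < n.spine, Does p (s j) (s (j + 1)) t) → (∀ j ≤ n.spine, (s j).size ≤ B) →
      Exec (.loop bit (.seq dropTop <| .seq swapTop <| .seq p <| .seq swapTop (pull .m)))
        (some (.inr n.code.head!)) (st i (n.code.tail ++ ((s 0).code ++ r)) [] [] [])
        (some (.inr false)) (st i ((s n.spine).code ++ r) [] [] [])
        (n.spine * (t + 47 * n.size + 40 * B + 50) + 1) := by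
    intro n
    induction n with
    | leaf => 
      intro s i r _ _
      simpa [Tr.code, Tr.spine] using Exec.loop_false rfl
    | node u w _ ihw =>
      intro s i r hs hB
      have h1 := hs 0 (by simp [Tr.spine]) i (w.code ++ r)
      have h2 := ihw (fun j => s (j + 1)) i r
        (fun j hj => hs (j + 1) (by simpa [Tr.spine] using hj))
        (fun j hj => hB (j + 1) (by simpa [Tr.spine] using hj))
      have h4 := hB 0 (by simp)
      have h5 := hB 1 (by simp [Tr.spine])
      have e1 := exec_pull_code (i := i) (a := []) (b := []) (c := []) (v := none)
        w ((s 1).code ++ r)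
      refine Exec.to (Exec.loop_true rfl (.seq (by simpa [Tr.code] using exec_dropTop u _) <|
        .seq (exec_swapTop w (s 0) r) <| .seq h1 <| .seq (exec_swapTop (s 1) w r) e1) h2) ?_ rfl
      simp only [Tr.spine, Tr.size]
      have : w.spine * (t + 47 * w.size + 40 * B + 50) ≤
        w.spine * (t + 47 * (u.size + w.size + 1) + 40 * B + 50) := by gcongr; omega
      rw [add_one_mul]
      omega
  intro i r
  have e1 := exec_pull_code (i := i) (a := []) (b := []) (c := []) (v := none) n ((s 0).code ++ r)
  refine Exec.to (Exec.seq exec_skim <| Exec.seq (by simpa [Tr.code] using e1) <|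
    Exec.seq (key n s i r h hB) exec_skim) ?_ (by simp)
  have h4 := n.spine_lt_size
  have h5 : (n.spine + 1) * (t + 47 * n.size + 40 * B + 60) ≤
    n.size * (t + 47 * n.size + 40 * B + 60) := Nat.mul_le_mul_right _ h4
  have h6 : n.spine * (t + 47 * n.size + 40 * B + 50) ≤
    n.spine * (t + 47 * n.size + 40 * B + 60) := by gcongr; omega
  rw [add_one_mul] at h5
  omega

end

end

end StackProg

/-! ### Functions computable in polynomial time -/

namespace StackProg

/-- Types whose elements are represented by trees. -/
class Enc (α : Type) where
  enc : α → Tr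
  inj : Function.Injective enc

open Enc (enc)

/-- The size of the tree that represents an element. -/
def esize {α : Type} [Enc α] (a : α) : ℕ := (enc a).size

instance : Enc Tr := ⟨id, Function.injective_id⟩

instance : Enc Bool :=
  ⟨fun b => cond b (.node .leaf .leaf) .leaf, fun a b => by cases a <;> cases b <;> simp⟩

/-- Numbers are represented in unary. -/
def encNum : ℕ → Tr
  | 0 => .leaf
  | n + 1 => .node .leaf (encNum n)

theorem encNum_injective : Function.Injective encNum := by
  intro m
  induction m with
  | zero => intro n h; cases n <;> simp_all [encNum]
  | succ m ih =>
    intro n h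
    cases n with
    | zero => simp [encNum] at h
    | succ n => simp only [encNum, Tr.node.injEq, true_and] at h; rw [ih h]

instance : Enc ℕ := ⟨encNum, encNum_injective⟩

instance {α β : Type} [Enc α] [Enc β] : Enc (α × β) :=
  ⟨fun p => .node (enc p.1) (enc p.2), fun p q h => by
    simp only [Tr.node.injEq] at h
    exact Prod.ext (Enc.inj h.1) (Enc.inj h.2)⟩

/-- Lists are represented by right spines. -/
def encListTr {α : Type} [Enc α] : List α → Tr
  | [] => .leaf
  | a :: l => .node (enc a) (encListTr l)

theorem encListTr_injective {α : Type} [Enc α] :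
    Function.Injective (encListTr : List α → Tr) := by
  intro l
  induction l with
  | nil => intro l' h; cases l' <;> simp_all [encListTr]
  | cons x l ih =>
    intro l' h
    cases l' with
    | nil => simp [encListTr] at h
    | cons y l' =>
      simp only [encListTr, Tr.node.injEq] at h
      rw [Enc.inj h.1, ih h.2]

instance {α : Type} [Enc α] : Enc (List α) := ⟨encListTr, encListTr_injective⟩

section
variable {α β : Type} [Enc α] [Enc β]
@[simp] theorem enc_tr (t : Tr) : enc t = t := rfl
@[simp] theorem enc_false : enc false = .leaf := rfl
@[simp] theorem enc_true : enc true = .node .leaf .leaf := rfl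
@[simp] theorem enc_zero : enc 0 = .leaf := rfl
@[simp] theorem enc_succ (n : ℕ) : enc (n + 1) = .node .leaf (enc n) := rfl
@[simp] theorem enc_pair (p : α × β) : enc p = .node (enc p.1) (enc p.2) := rfl
@[simp] theorem enc_nil : enc ([] : List α) = .leaf := rfl
@[simp] theorem enc_cons (a : α) (l : List α) : enc (a :: l) = .node (enc a) (enc l) := rfl

@[simp] theorem esize_false : esize false = 1 := rfl
@[simp] theorem esize_true : esize true = 3 := rfl
@[simp] theorem esize_pair (p : α × β) : esize p = esize p.1 + esize p.2 + 1 := rfl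
@[simp] theorem esize_nil : esize ([] : List α) = 1 := rfl
@[simp] theorem esize_cons (a : α) (l : List α) : esize (a :: l) = esize a + esize l + 1 := rfl
@[simp] theorem esize_num (n : ℕ) : esize n = 2 * n + 1 := by
  induction n with
  | zero => rfl
  | succ n ih => rw [show esize (n + 1) = 1 + esize n + 1 from rfl, ih]; ring
theorem esize_pos (a : α) : 0 < esize a := Tr.size_pos _
theorem esize_bool_le (b : Bool) : esize b ≤ 3 := by cases b <;> simp
theorem esize_enc (a : α) : esize (enc a) = esize a := rfl

@[simp] theorem spine_enc_num (n : ℕ) : (enc n).spine = n := by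
  induction n with
  | zero => rfl
  | succ n ih => simp [Tr.spine, ih]

@[simp] theorem spine_enc_list (l : List α) : (enc l).spine = l.length := by
  induction l with
  | nil => rfl
  | cons a l ih => simp [Tr.spine, ih]

theorem length_le_esize (l : List α) : l.length ≤ esize l := by
  rw [← spine_enc_list l]; exact (Tr.spine_lt_size _).le

theorem esize_append (l l' : List α) : esize (l ++ l') + 1 = esize l + esize l' := by
  induction l with
  | nil => simp [add_comm]
  | cons a l ih => simp only [List.cons_append, esize_cons]; omega

theorem esize_reverse (l : List α) : esize l.reverse = esize l := by
  induction l with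
  | nil => rfl
  | cons a l ih =>
    have := esize_append l.reverse [a]
    simp only [List.reverse_cons, esize_cons, esize_nil] at this ⊢
    omega

theorem esize_le_of_mem {l : List α} {a : α} (h : a ∈ l) : esize a ≤ esize l := by
  induction l with
  | nil => simp at h
  | cons b l ih =>
    rcases List.mem_cons.1 h with rfl | h
    · simp only [esize_cons]; omega
    · have := ih h; simp only [esize_cons]; omega

theorem esize_le_of_forall {l : List α} {B : ℕ} (h : ∀ a ∈ l, esize a ≤ B) :
    esize l ≤ l.length * (B + 1) + 1 := by
  induction l with
  | nil => simp
  | cons a l ih =>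
    have h1 := ih fun x hx => h x (List.mem_cons_of_mem _ hx)
    have h2 := h a List.mem_cons_self
    simp only [esize_cons, List.length_cons]
    rw [add_one_mul]
    omega

theorem esize_le_of_sublist {l l' : List α} (h : l.Sublist l') : esize l ≤ esize l' := by
  induction h with
  | slnil => exact le_rfl
  | cons a _ ih => simp only [esize_cons]; omega
  | cons_cons a _ ih => simp only [esize_cons]; omega
end

/-! #### Polynomial bounds -/

theorem eval_mono (P : Polynomial ℕ) {m n : ℕ} (h : m ≤ n) : P.eval m ≤ P.eval n := by
  induction P using Polynomial.induction_on' with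
  | add p q hp hq => simpa using add_le_add hp hq
  | monomial k c => simpa using Nat.mul_le_mul_left _ (Nat.pow_le_pow_left h _)

/-- `g` is bounded by a polynomial in the size of its argument. -/
def PolyBdd {α : Type} [Enc α] (g : α → ℕ) : Prop :=
  ∃ P : Polynomial ℕ, ∀ a, g a ≤ P.eval (esize a)

namespace PolyBdd
variable {α β : Type} [Enc α] [Enc β] {g h : α → ℕ}

theorem of_le (hh : PolyBdd h) (hg : ∀ a, g a ≤ h a) : PolyBdd g := by
  obtain ⟨P, hP⟩ := hh
  exact ⟨P, fun a => (hg a).trans (hP a)⟩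

theorem const (c : ℕ) : PolyBdd fun _ : α => c := ⟨Polynomial.C c, fun a => by simp⟩

theorem size : PolyBdd fun a : α => esize a := ⟨Polynomial.X, fun a => by simp⟩

theorem add (hg : PolyBdd g) (hh : PolyBdd h) : PolyBdd fun a => g a + h a := by
  obtain ⟨P, hP⟩ := hg
  obtain ⟨Q, hQ⟩ := hh
  exact ⟨P + Q, fun a => by simpa using add_le_add (hP a) (hQ a)⟩

theorem mul (hg : PolyBdd g) (hh : PolyBdd h) : PolyBdd fun a => g a * h a := by
  obtain ⟨P, hP⟩ := hg
  obtain ⟨Q, hQ⟩ := hh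
  exact ⟨P * Q, fun a => by simpa using Nat.mul_le_mul (hP a) (hQ a)⟩

theorem eval (P : Polynomial ℕ) (hg : PolyBdd g) : PolyBdd fun a => P.eval (g a) := by
  obtain ⟨Q, hQ⟩ := hg
  exact ⟨P.comp Q, fun a => by simpa using eval_mono P (hQ a)⟩

theorem comp {g : β → ℕ} {f : α → β} (hg : PolyBdd g) (hf : PolyBdd fun a => esize (f a)) :
    PolyBdd fun a => g (f a) := by
  obtain ⟨P, hP⟩ := hg
  exact (hf.eval P).of_le fun a => hP (f a)

end PolyBdd

/-! ### Polynomial time and its basic closure properties. -/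

/-- The programs used for computing with trees. -/
abbrev Pg : Type := Pr LCP.Symb

/-- `f` is computable in polynomial time. -/
@[fun_prop]
def PTime {α β : Type} [Enc α] [Enc β] (f : α → β) : Prop :=
  ∃ (p : Pg) (t : α → ℕ), PolyBdd t ∧ ∀ a, Does p (enc a) (enc (f a)) (t a)

namespace PTime
variable {α β γ δ : Type} [Enc α] [Enc β] [Enc γ] [Enc δ]

/-- A program pushes at most one cell per unit of time, so a time bound is also a bound on the
growth of the output. This is what makes composition work. -/
theorem size {f : α → β} (hf : PTime f) : PolyBdd fun a => esize (f a) := by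
  obtain ⟨p, t, ht, h⟩ := hf
  exact (PolyBdd.size.add ht).of_le fun a => (h a).size_le

/-- Only the representation of the values of a function matters. -/
theorem of_enc {f : α → β} {g : α → γ} (hf : PTime f) (h : ∀ a, enc (f a) = enc (g a)) :
    PTime g := by
  obtain ⟨p, t, ht, hp⟩ := hf
  exact ⟨p, t, ht, fun a => h a ▸ hp a⟩

@[fun_prop]
theorem comp {g : β → γ} {f : α → β} (hg : PTime g) (hf : PTime f) : PTime fun a => g (f a) := by
  have hs := hf.size
  obtain ⟨p, t, ht, hp⟩ := hf
  obtain ⟨q, u, hu, hq⟩ := hg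
  exact ⟨.seq p q, fun a => t a + u (f a), ht.add (hu.comp hs), fun a => (hp a).seq (hq (f a))⟩

theorem leaf : PTime fun _ : α => Tr.leaf :=
  ⟨opLeaf, fun a => 7 * esize a + 8,
    (((PolyBdd.const 7).mul .size).add (.const 8)), fun a => does_opLeaf (enc a)⟩

theorem dup : PTime fun a : α => (a, a) :=
  ⟨opDup, fun a => 20 * esize a + 20,
    (((PolyBdd.const 20).mul .size).add (.const 20)), fun a => does_opDup (enc a)⟩

theorem swap : PTime fun p : α × β => (p.2, p.1) :=
  ⟨opSwap, fun p => 20 * esize p + 22, (((PolyBdd.const 20).mul .size).add (.const 22)),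
    fun p => (does_opSwap (enc p.1) (enc p.2)).mono (by simp [esize, Tr.size])⟩

@[fun_prop]
theorem id : PTime fun a : α => a := by
  have h := (dup (α := α))
  obtain ⟨p, t, ht, hp⟩ := h
  -- There is no empty program, so the argument is duplicated and one copy dropped.
  exact ⟨.seq p opSnd, fun a => t a + (7 * esize a + 8),
    ht.add (((PolyBdd.const 7).mul .size).add (.const 8)),
    fun a => (hp a).seq (does_opSnd (enc a) (enc a))⟩

theorem snd' : PTime fun p : α × β => p.2 :=
  ⟨opSnd, fun p => 7 * esize p + 8, (((PolyBdd.const 7).mul .size).add (.const 8)),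
    fun p => (does_opSnd (enc p.1) (enc p.2)).mono (by simp [esize, Tr.size]; omega)⟩

theorem fst' : PTime fun p : α × β => p.1 := snd'.comp swap

@[fun_prop]
theorem fst {f : α → β × γ} (hf : PTime f) : PTime fun a => (f a).1 := fst'.comp hf

@[fun_prop]
theorem snd {f : α → β × γ} (hf : PTime f) : PTime fun a => (f a).2 := snd'.comp hf

theorem first {f : α → β} (hf : PTime f) : PTime fun p : α × γ => (f p.1, p.2) := by
  obtain ⟨p, t, ht, hp⟩ := hf
  refine ⟨opFirst p, fun q => t q.1 + 2, (ht.comp fst'.size).add (.const 2), fun q => ?_⟩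
  exact (hp q.1).opFirst (enc q.2)

@[fun_prop]
theorem pair {f : α → β} {g : α → γ} (hf : PTime f) (hg : PTime g) :
    PTime fun a => (f a, g a) :=
  swap.comp ((first hg).comp (swap.comp ((first hf).comp dup)))

@[fun_prop]
theorem const (b : β) : PTime fun _ : α => b := by
  have key : ∀ t : Tr, PTime fun _ : α => t := by
    intro t
    induction t with
    | leaf => exact leaf
    | node x y hx hy => exact (hx.pair hy).of_enc fun _ => rfl
  exact (key (enc b)).of_enc fun _ => rfl

theorem branch {h : α → Tr} {f g : α → β} (hh : PTime h) (hf : PTime f) (hg : PTime g) :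
    PTime fun a => (match h a with | .leaf => f a | .node _ _ => g a) := by
  have h0 := hh.pair (id (α := α))
  have hs := hh.size
  obtain ⟨p, t, ht, hp⟩ := hf
  obtain ⟨q, u, hu, hq⟩ := hg
  obtain ⟨r, w, hw, hr⟩ := h0
  refine ⟨.seq r (opBranch q p), fun a => w a + (7 * esize (h a) + t a + u a + 20),
    hw.add (((((PolyBdd.const 7).mul hs).add ht).add hu).add (.const 20)), fun a => ?_⟩
  refine (hr a).seq ?_
  cases e : h a with
  | leaf =>
    simpa [e] using ((hp a).opBranch_leaf q).mono (by omega)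
  | node x y =>
    simpa [e] using ((hq a).opBranch_node p x y).mono (by simp [esize, Tr.size]; omega)

@[fun_prop]
theorem bcond {c : α → Bool} {f g : α → β} (hc : PTime c) (hf : PTime f) (hg : PTime g) :
    PTime fun a => bif c a then f a else g a := by
  refine (branch (h := fun a => enc (c a)) (hc.of_enc fun _ => rfl) hg hf).of_enc fun a => ?_
  cases c a <;> rfl

@[fun_prop]
theorem ite {c : α → Prop} [DecidablePred c] {f g : α → β} (hc : PTime fun a => decide (c a))
    (hf : PTime f) (hg : PTime g) : PTime fun a => if c a then f a else g a := by
  refine (bcond hc hf hg).of_enc fun a => ?_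
  by_cases h : c a <;> simp [h]

@[fun_prop]
theorem enc' : PTime fun a : α => enc a := id.of_enc fun _ => rfl

@[fun_prop]
-- A nonempty list and the pair of its head and tail have the same tree. Branching on a spare copy
-- of `l a` leaves `(a, l a)`, which in the second case is already the encoding of the argument `(a,
-- x, t)` of `g`.
theorem listCases {l : α → List γ} {f : α → β} {g : α → γ → List γ → β} (hl : PTime l)
    (hf : PTime f) (hg : PTime fun p : α × γ × List γ => g p.1 p.2.1 p.2.2) :
    PTime fun a => (match l a with | [] => f a | x :: t => g a x t) := by
  have h0 := hl.pair (id.pair hl)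
  have h1 := hf.comp (fst' (α := α) (β := List γ))
  have hs := hl.size
  have hs' := (id.pair hl).size
  obtain ⟨p, t, ht, hp⟩ := h1
  obtain ⟨q, u, ⟨P, hP⟩, hq⟩ := hg
  obtain ⟨r, w, hw, hr⟩ := h0
  refine ⟨.seq r (opBranch q p),
    fun a => w a + (7 * esize (l a) + t (a, l a) + P.eval (esize (a, l a)) + 20),
    hw.add (((((PolyBdd.const 7).mul hs).add (ht.comp hs')).add (hs'.eval P)).add (.const 20)),
    fun a => ?_⟩
  refine (hr a).seq ?_
  have hp' := hp (a, l a)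
  cases e : l a with
  | nil =>
    rw [e] at hp'
    simpa [e] using (hp'.opBranch_leaf q).mono (by omega)
  | cons x t =>
    have h3 := hP (a, x, t)
    simpa [e] using ((hq (a, x, t)).opBranch_node p (enc x) (enc t)).mono
      (by
        simp only [esize_pair] at h3; simp [esize] at h3 ⊢; omega)

/-- The bound `B` on all intermediate values is essential: iterating a polynomial-time step, such as
doubling, may otherwise produce values of exponential size. The parameter `a` is carried along
beside the state. -/
theorem iterateSpine {c : α → Tr} {s : α → β} {f : α → β → β} (hc : PTime c) (hs : PTime s)
    (hf : PTime fun p : α × β => f p.1 p.2) {B : α → ℕ} (hB : PolyBdd B)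
    (h : ∀ a, ∀ i ≤ (c a).spine, esize ((f a)^[i] (s a)) ≤ B a) :
    PTime fun a => (f a)^[(c a).spine] (s a) := by
  have h0 := hc.pair (id.pair hs)
  have h1 := fst'.pair hf
  have hcs := hc.size
  obtain ⟨p, t, ht, hp⟩ := h0
  obtain ⟨q, u, ⟨P, hP⟩, hq⟩ := h1
  have h2 : PTime fun a => (a, (f a)^[(c a).spine] (s a)) := by
    refine ⟨.seq p (opIter q), fun a => t a + esize (c a) * (P.eval (esize a + B a + 1) +
      47 * esize (c a) + 40 * (esize a + B a + 1) + 60), ?_, fun a => ?_⟩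
    · have h3 := (PolyBdd.size.add hB).add (.const 1)
      exact ht.add (hcs.mul ((((h3.eval P).add ((PolyBdd.const 47).mul hcs)).add
        ((PolyBdd.const 40).mul h3)).add (.const 60)))
    · refine (hp a).seq ?_
      have h4 : ∀ i ≤ (c a).spine, esize (a, (f a)^[i] (s a)) ≤ esize a + B a + 1 := by
        intro i hi
        have := h a i hi
        simp only [esize_pair]
        omega
      refine does_opIter (c a) (fun i => enc (a, (f a)^[i] (s a))) (fun i hi => ?_) h4
      have h5 := hq (a, (f a)^[i] (s a))
      simp only [← Function.iterate_succ_apply'] at h5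
      refine h5.mono ?_
      exact (hP _).trans (eval_mono P (h4 i hi.le))
  exact snd'.comp h2

theorem iterate {n : α → ℕ} {s : α → β} {f : α → β → β} (hn : PTime n) (hs : PTime s)
    (hf : PTime fun p : α × β => f p.1 p.2) {B : α → ℕ} (hB : PolyBdd B)
    (h : ∀ a, ∀ i ≤ n a, esize ((f a)^[i] (s a)) ≤ B a) :
    PTime fun a => (f a)^[n a] (s a) := by
  simpa using iterateSpine (hn.of_enc (g := fun a => enc (n a)) fun _ => rfl) hs hf hB
    (by simpa using h)

end PTime
end StackProg

/-! #### Polynomial time functions on trees, numbers and lists -/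

theorem Tr.code_append_inj : ∀ {x y : Tr} {r s : List Bool}, x.code ++ r = y.code ++ s →
    x = y ∧ r = s := by
  intro x
  induction x with
  | leaf => intro y r s h; cases y <;> simp_all [Tr.code]
  | node x₁ x₂ ih₁ ih₂ =>
    intro y r s h
    cases y with
    | leaf => simp [Tr.code] at h
    | node y₁ y₂ =>
      simp only [Tr.code, List.cons_append, List.append_assoc, List.cons.injEq, true_and] at h
      obtain ⟨rfl, h'⟩ := ih₁ h
      obtain ⟨rfl, h''⟩ := ih₂ h'
      exact ⟨rfl, h''⟩

theorem Tr.code_injective : Function.Injective Tr.code := fun x y h =>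
  (Tr.code_append_inj (r := []) (s := []) (by simpa using h)).1

namespace StackProg
open Enc (enc)

namespace PTime
variable {α β γ δ : Type} [Enc α] [Enc β] [Enc γ] [Enc δ]

@[fun_prop]
theorem cons {f : α → β} {g : α → List β} (hf : PTime f) (hg : PTime g) :
    PTime fun a => f a :: g a := (hf.pair hg).of_enc fun _ => rfl

@[fun_prop]
theorem succ {f : α → ℕ} (hf : PTime f) : PTime fun a => f a + 1 :=
  ((leaf (α := α)).pair hf).of_enc fun _ => rfl

@[fun_prop]
theorem node {f g : α → Tr} (hf : PTime f) (hg : PTime g) : PTime fun a => Tr.node (f a) (g a) :=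
  (hf.pair hg).of_enc fun _ => rfl

@[fun_prop]
theorem tail {f : α → List β} (hf : PTime f) : PTime fun a => (f a).tail := by
  refine (listCases (g := fun _ _ t => t) hf (const ([] : List β)) (by fun_prop)).of_enc ?_
  intro a
  cases f a <;> rfl

@[fun_prop]
theorem headD {f : α → List β} {g : α → β} (hf : PTime f) (hg : PTime g) :
    PTime fun a => (f a).headD (g a) := by
  refine (listCases (g := fun _ x _ => x) hf hg (by fun_prop)).of_enc ?_
  intro a
  cases f a <;> rfl

/-- A fold is an iteration on pairs of the remaining list and the accumulator, with the list itself
as the counter. -/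
theorem foldl {l : α → List γ} {s : α → β} {f : α → β → γ → β} (hl : PTime l) (hs : PTime s)
    (hf : PTime fun p : α × β × γ => f p.1 p.2.1 p.2.2) {B : α → ℕ} (hB : PolyBdd B)
    (h : ∀ a l', l' <+: l a → esize (l'.foldl (f a) (s a)) ≤ B a) :
    PTime fun a => (l a).foldl (f a) (s a) := by
  let step : α → List γ × β → List γ × β := fun a q =>
    match q.1 with
    | [] => q
    | x :: t => (t, f a q.2 x)
  have hf' : PTime fun p : (α × List γ × β) × γ × List γ => f p.1.1 p.1.2.2 p.2.1 :=
    hf.comp (f := fun p : (α × List γ × β) × γ × List γ => (p.1.1, p.1.2.2, p.2.1)) (by fun_prop)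
  have hstep : PTime fun p : α × List γ × β => step p.1 p.2 :=
    (listCases (l := fun p : α × List γ × β => p.2.1) (f := fun p => p.2)
      (g := fun p x t => (t, f p.1 p.2.2 x)) (by fun_prop) (by fun_prop)
      (by fun_prop)).of_enc fun p => by rcases p with ⟨a, _ | _, b⟩ <;> rfl
  have key : ∀ a i, i ≤ (l a).length →
      (step a)^[i] (l a, s a) = ((l a).drop i, ((l a).take i).foldl (f a) (s a)) := by
    intro a i
    induction i with
    | zero => simp
    | succ i ih =>
      intro hi
      rw [Function.iterate_succ_apply', ih (by omega)]
      have h1 := List.drop_eq_getElem_cons (show i < (l a).length by omega)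
      simp only [step, h1, List.take_add_one, List.foldl_append,
        List.getElem?_eq_getElem (show i < (l a).length by omega), Option.toList_some,
        List.foldl_cons, List.foldl_nil]
  have h1 := iterateSpine (c := fun a => enc (l a)) (s := fun a => (l a, s a)) (f := step)
    (hl.of_enc fun _ => rfl) (by fun_prop) hstep (B := fun a => esize (l a) + B a + 1)
    ((hl.size.add hB).add (.const 1)) (by
      intro a i hi
      rw [spine_enc_list] at hi
      rw [key a i hi, esize_pair]
      have h2 := h a _ (List.take_prefix i (l a))
      have h3 := esize_le_of_sublist (List.drop_sublist i (l a))
      simp only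
      omega)
  refine h1.snd.of_enc fun a => ?_
  simp only [spine_enc_list]
  rw [key a _ le_rfl]
  simp

@[fun_prop]
theorem reverse {l : α → List β} (hl : PTime l) : PTime fun a => (l a).reverse := by
  refine (foldl (s := fun _ => ([] : List β)) (f := fun _ acc x => x :: acc) hl (by fun_prop)
    (by fun_prop) hl.size ?_).of_enc ?_
  · intro a l' h
    have : ∀ (l acc : List β), l.foldl (fun acc x => x :: acc) acc = l.reverse ++ acc := by
      intro l; induction l <;> simp_all
    rw [this, List.append_nil, esize_reverse]
    exact esize_le_of_sublist h.sublist
  · intro a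
    rw [List.foldl_flip_cons_eq_append']
    simp

theorem foldr {l : α → List γ} {s : α → β} {f : α → γ → β → β} (hl : PTime l) (hs : PTime s)
    (hf : PTime fun p : α × γ × β => f p.1 p.2.1 p.2.2) {B : α → ℕ} (hB : PolyBdd B)
    (h : ∀ a l', l' <:+ l a → esize (l'.foldr (f a) (s a)) ≤ B a) :
    PTime fun a => (l a).foldr (f a) (s a) := by
  refine (foldl (f := fun a b x => f a x b) hl.reverse hs
    (hf.comp (f := fun p : α × β × γ => (p.1, p.2.2, p.2.1)) (by fun_prop)) hB ?_).of_enc ?_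
  · intro a l' hl'
    have := h a l'.reverse (by simpa using List.reverse_suffix.2 hl')
    rwa [List.foldr_reverse] at this
  · intro a
    rw [List.foldl_reverse]

@[fun_prop]
theorem map {l : α → List γ} {g : α → γ → β} (hl : PTime l)
    (hg : PTime fun p : α × γ => g p.1 p.2) : PTime fun a => (l a).map (g a) := by
  obtain ⟨P, hP⟩ := hg.size
  have hf : PTime fun p : α × γ × List β => g p.1 p.2.1 :=
    hg.comp (f := fun p : α × γ × List β => (p.1, p.2.1)) (by fun_prop)
  refine (foldr (s := fun _ => ([] : List β)) (f := fun a x acc => g a x :: acc) hl (by fun_prop)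
    (by fun_prop) (B := fun a => esize (l a) * (P.eval (esize a + esize (l a) + 1) + 1) + 1)
    ((hl.size.mul ((((PolyBdd.size.add hl.size).add (.const 1)).eval P).add (.const 1))).add
      (.const 1)) ?_).of_enc ?_
  · intro a l' h
    rw [← List.map_eq_foldr]
    refine (esize_le_of_forall (B := P.eval (esize a + esize (l a) + 1)) ?_).trans ?_
    · intro y hy
      obtain ⟨x, hx, rfl⟩ := List.mem_map.1 hy
      refine (hP (a, x)).trans (eval_mono P ?_)
      have := esize_le_of_mem (h.subset hx)
      simp only [esize_pair]
      omega
    · gcongr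
      rw [List.length_map]
      exact h.length_le.trans (length_le_esize _)
  · intro a
    rw [← List.map_eq_foldr]

@[fun_prop]
theorem append {f g : α → List β} (hf : PTime f) (hg : PTime g) : PTime fun a => f a ++ g a := by
  refine (foldr (s := g) (f := fun _ x acc => x :: acc) hf hg
    (by fun_prop) (hf.size.add hg.size) ?_).of_enc ?_
  · intro a l' h
    rw [List.foldr_cons_eq_append']
    have h1 := esize_append l' (g a)
    have h2 := esize_le_of_sublist h.sublist
    omega
  · intro a
    rw [List.foldr_cons_eq_append']

@[fun_prop]
theorem flatten {l : α → List (List β)} (hl : PTime l) : PTime fun a => (l a).flatten := by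
  refine (foldr (s := fun _ => ([] : List β)) (f := fun _ x acc => x ++ acc) hl (by fun_prop)
    (by fun_prop) hl.size ?_).of_enc ?_
  · intro a l' h
    refine le_trans ?_ (esize_le_of_sublist h.sublist)
    clear h
    induction l' with
    | nil => simp
    | cons x l' ih =>
      have := esize_append x (l'.foldr (fun x acc => x ++ acc) [])
      simp only [List.foldr_cons, esize_cons]
      omega
  · intro a
    congr 1
    induction l a <;> simp_all

@[fun_prop]
theorem flatMap {l : α → List γ} {g : α → γ → List β} (hl : PTime l)
    (hg : PTime fun p : α × γ => g p.1 p.2) : PTime fun a => (l a).flatMap (g a) := by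
  refine ((map hl hg).flatten).of_enc fun a => ?_
  rw [List.flatMap_def]

@[fun_prop]
theorem filter {l : α → List γ} {g : α → γ → Bool} (hl : PTime l)
    (hg : PTime fun p : α × γ => g p.1 p.2) : PTime fun a => (l a).filter (g a) := by
  have hf : PTime fun p : α × γ × List γ => g p.1 p.2.1 :=
    hg.comp (f := fun p : α × γ × List γ => (p.1, p.2.1)) (by fun_prop)
  have h1 : ∀ (p : γ → Bool) (l : List γ),
      l.foldr (fun x acc => bif p x then x :: acc else acc) [] = l.filter p := by
    intro p l
    induction l with
    | nil => rfl
    | cons x l ih => cases h : p x <;> simp_all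
  refine (foldr (s := fun _ => ([] : List γ))
    (f := fun a x acc => bif g a x then x :: acc else acc) hl (by fun_prop)
    (by fun_prop) hl.size ?_).of_enc ?_
  · intro a l' h
    rw [h1]
    exact esize_le_of_sublist (List.filter_sublist.trans h.sublist)
  · intro a
    rw [h1]

@[fun_prop]
theorem and {f g : α → Bool} (hf : PTime f) (hg : PTime g) : PTime fun a => f a && g a :=
  (bcond hf hg (const false)).of_enc fun a => by cases f a <;> rfl

@[fun_prop]
theorem or {f g : α → Bool} (hf : PTime f) (hg : PTime g) : PTime fun a => f a || g a :=
  (bcond hf (const true) hg).of_enc fun a => by cases f a <;> rfl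

@[fun_prop]
theorem not {f : α → Bool} (hf : PTime f) : PTime fun a => !f a :=
  (bcond hf (const false) (const true)).of_enc fun a => by cases f a <;> rfl

@[fun_prop]
theorem all {l : α → List γ} {g : α → γ → Bool} (hl : PTime l)
    (hg : PTime fun p : α × γ => g p.1 p.2) : PTime fun a => (l a).all (g a) := by
  have hf : PTime fun p : α × γ × Bool => g p.1 p.2.1 :=
    hg.comp (f := fun p : α × γ × Bool => (p.1, p.2.1)) (by fun_prop)
  refine (foldr (s := fun _ => true) (f := fun a x acc => g a x && acc) hl (by fun_prop)
    (by fun_prop) (.const 3) fun a l' _ => esize_bool_le _).of_enc fun a => ?_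
  congr 1
  induction l a <;> simp_all

@[fun_prop]
theorem any {l : α → List γ} {g : α → γ → Bool} (hl : PTime l)
    (hg : PTime fun p : α × γ => g p.1 p.2) : PTime fun a => (l a).any (g a) := by
  have hf : PTime fun p : α × γ × Bool => g p.1 p.2.1 :=
    hg.comp (f := fun p : α × γ × Bool => (p.1, p.2.1)) (by fun_prop)
  refine (foldr (s := fun _ => false) (f := fun a x acc => g a x || acc) hl (by fun_prop)
    (by fun_prop) (.const 3) fun a l' _ => esize_bool_le _).of_enc fun a => ?_
  congr 1
  induction l a <;> simp_all

theorem treeCode : PTime Tr.code := by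
  refine ⟨opCode, fun x => 20 * esize x + 20, ((PolyBdd.const 20).mul .size).add (.const 20),
    fun x => ?_⟩
  have h : ∀ l : List Bool, bitsTr l = enc l := by
    intro l
    induction l with
    | nil => rfl
    | cons b l ih => rw [bitsTr, ih]; rfl
  rw [← h]
  exact does_opCode x

@[fun_prop]
theorem isEmpty {l : α → List β} (hl : PTime l) : PTime fun a => (l a).isEmpty :=
  (listCases (g := fun _ _ _ => false) hl (const true) (by fun_prop)).of_enc fun a => by
    cases l a <;> rfl

/-- Compare a bit with the first entry of a list of bits. -/
def eqBitsStep (q : Bool × List Bool) (b : Bool) : Bool × List Bool :=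
  match q.2 with
  | [] => (false, [])
  | b' :: t => (q.1 && (bif b then b' else !b'), t)

/-- Equality of lists of bits. -/
def eqBits (l l' : List Bool) : Bool :=
  (l.foldl eqBitsStep (true, l')).1 && (l.foldl eqBitsStep (true, l')).2.isEmpty

theorem eqBits_iff (l l' : List Bool) : eqBits l l' = true ↔ l = l' := by
  have key : ∀ (l l' : List Bool) (c : Bool), ((l.foldl eqBitsStep (c, l')).1 = true ∧
      (l.foldl eqBitsStep (c, l')).2 = []) ↔ c = true ∧ l = l' := by
    intro l
    induction l with
    | nil => intro l' c; simp [eq_comm]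
    | cons b l ih =>
      intro l' c
      cases l' with
      | nil => simp only [List.foldl_cons, eqBitsStep]; rw [ih]; simp
      | cons b' l' =>
        simp only [List.foldl_cons, eqBitsStep]; rw [ih]
        cases b <;> cases b' <;> simp
  simpa [eqBits] using key l l' true

theorem eqBits' {f g : α → List Bool} (hf : PTime f) (hg : PTime g) :
    PTime fun a => eqBits (f a) (g a) := by
  have hstep : PTime fun p : (Bool × List Bool) × Bool => eqBitsStep p.1 p.2 :=
    (listCases (l := fun p : (Bool × List Bool) × Bool => p.1.2) (f := fun p => (false, []))
      (g := fun p b' t => (p.1.1 && (bif p.2 then b' else !b'), t)) (by fun_prop) (by fun_prop)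
      (by fun_prop)).of_enc fun p => by rcases p with ⟨⟨_, _ | _⟩, _⟩ <;> rfl
  have hsize : ∀ (l : List Bool) (q : Bool × List Bool),
      esize (l.foldl eqBitsStep q).2 ≤ esize q.2 := by
    intro l
    induction l with
    | nil => intro q; simp
    | cons b l ih =>
      intro q
      refine (ih _).trans ?_
      rcases q with ⟨c, _ | ⟨b', t⟩⟩
      · simp [eqBitsStep]
      · simp only [eqBitsStep, esize_cons]; omega
  have h := foldl (s := fun a => (true, g a)) (f := fun _ => eqBitsStep) hf (by fun_prop)
    (hstep.comp (f := fun p : α × (Bool × List Bool) × Bool => (p.2.1, p.2.2)) (by fun_prop))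
    (B := fun a => esize (g a) + 4) (hg.size.add (.const 4)) (by
      intro a l' _
      have h1 := hsize l' (true, g a)
      have h2 := esize_bool_le (l'.foldl eqBitsStep (true, g a)).1
      rw [esize_pair]
      simp only at h1
      omega)
  exact h.fst.and h.snd.isEmpty

@[fun_prop]
-- Encodings and tree codes are injective, so equality can be tested bit by bit on the codes.
theorem eq [DecidableEq β] {f g : α → β} (hf : PTime f) (hg : PTime g) :
    PTime fun a => decide (f a = g a) := by
  have h1 : PTime fun a => enc (f a) := hf.of_enc fun _ => rfl
  have h2 : PTime fun a => enc (g a) := hg.of_enc fun _ => rfl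
  refine (eqBits' (treeCode.comp h1) (treeCode.comp h2)).of_enc fun a => ?_
  congr 1
  rw [Bool.eq_iff_iff, eqBits_iff, decide_eq_true_iff, Tr.code_injective.eq_iff, Enc.inj.eq_iff]

/-- A finite index allows a separate program for each value, selected by a chain of equality tests.
-/
theorem finCases [Fintype γ] [DecidableEq γ] {g : α → γ} {f : γ → α → β} (hg : PTime g)
    (hf : ∀ c, PTime (f c)) : PTime fun a => f (g a) a := by
  have key : ∀ (l : List γ) (c₀ : γ), ∃ h : α → β, PTime h ∧ ∀ a, g a ∈ l → h a = f (g a) a := by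
    intro l c₀
    induction l with
    | nil => exact ⟨f c₀, hf c₀, by simp⟩
    | cons c l ih =>
      obtain ⟨h, hh, hh'⟩ := ih
      refine ⟨fun a => if g a = c then f c a else h a, ite (hg.eq (const c)) (hf c) hh, ?_⟩
      intro a ha
      by_cases e : g a = c
      · simp [e]
      · simpa [e] using hh' a (by simpa [e] using ha)
  -- An element of `α` supplies the value `g a₀` with which the chain of tests ends; without one,
  -- any program will do.
  rcases isEmpty_or_nonempty α with hα | ⟨⟨a₀⟩⟩
  · obtain ⟨p, t, ht, -⟩ := hg
    exact ⟨p, t, ht, fun a => hα.elim a⟩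
  · obtain ⟨h, hh, hh'⟩ := key Finset.univ.toList (g a₀)
    exact hh.of_enc fun a => by rw [hh' a (by simp)]

@[fun_prop]
theorem length {l : α → List β} (hl : PTime l) : PTime fun a => (l a).length := by
  have key : ∀ (l : List β) (n : ℕ), l.foldl (fun n _ => n + 1) n = n + l.length := by
    intro l
    induction l with
    | nil => simp
    | cons x l ih => intro n; simp [ih]; omega
  refine (foldl (s := fun _ => 0) (f := fun _ n _ => n + 1) hl (by fun_prop) (by fun_prop)
    (B := fun a => 2 * esize (l a) + 1) (((PolyBdd.const 2).mul hl.size).add (.const 1))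
    ?_).of_enc fun a => ?_
  · intro a l' h
    have h1 := h.length_le.trans (length_le_esize _)
    rw [key, esize_num]
    omega
  · rw [key, zero_add]

theorem spine {f : α → Tr} (hf : PTime f) : PTime fun a => (f a).spine := by
  have key : ∀ i : ℕ, (fun n : ℕ => n + 1)^[i] 0 = i := by
    intro i; induction i <;> simp_all [Function.iterate_succ_apply']
  refine (iterateSpine (s := fun _ => 0) (f := fun _ n => n + 1) hf (by fun_prop) (by fun_prop)
    (B := fun a => 2 * esize (f a) + 1) (((PolyBdd.const 2).mul hf.size).add (.const 1))
    ?_).of_enc fun a => ?_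
  · intro a i hi
    have h1 := hi.trans (Tr.spine_lt_size (f a)).le
    rw [key, esize_num]
    simp only [esize, enc_tr]
    omega
  · rw [key]

@[fun_prop]
theorem natAdd {f g : α → ℕ} (hf : PTime f) (hg : PTime g) : PTime fun a => f a + g a := by
  have key : ∀ i n : ℕ, (fun n : ℕ => n + 1)^[i] n = n + i := by
    intro i n
    induction i with
    | zero => rfl
    | succ i ih => rw [Function.iterate_succ_apply', ih]; rfl
  refine (iterate (s := f) (f := fun _ n => n + 1) hg hf (by fun_prop)
    (hf.size.add hg.size) ?_).of_enc fun a => ?_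
  · intro a i hi
    rw [key]
    simp only [esize_num]
    omega
  · rw [key]

@[fun_prop]
theorem natMul {f g : α → ℕ} (hf : PTime f) (hg : PTime g) : PTime fun a => f a * g a := by
  have hg' := hg.comp (fst' (α := α) (β := ℕ))
  have key : ∀ i n : ℕ, (fun m : ℕ => m + n)^[i] 0 = i * n := by
    intro i n
    induction i with
    | zero => simp
    | succ i ih => rw [Function.iterate_succ_apply', ih]; ring
  refine (iterate (s := fun _ => 0) (f := fun a n => n + g a) hf (by fun_prop) (by fun_prop)
    (hf.size.mul hg.size) ?_).of_enc fun a => ?_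
  · intro a i hi
    rw [key]
    simp only [esize_num]
    nlinarith [Nat.mul_le_mul_right (g a) hi]
  · rw [key]

@[fun_prop]
theorem range {f : α → ℕ} (hf : PTime f) : PTime fun a => List.range (f a) := by
  have key : ∀ i : ℕ, (fun l : List ℕ => l ++ [l.length])^[i] [] = List.range i := by
    intro i
    induction i with
    | zero => simp
    | succ i ih => rw [Function.iterate_succ_apply', ih, List.range_succ]; simp
  refine (iterate (s := fun _ => []) (f := fun _ (l : List ℕ) => l ++ [l.length]) hf
    (by fun_prop) (by fun_prop) (B := fun a => esize (f a) * (esize (f a) + 1) + 1)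
    ((hf.size.mul (hf.size.add (.const 1))).add (.const 1)) ?_).of_enc fun a => ?_
  · intro a i hi
    rw [key]
    refine (esize_le_of_forall (B := esize (f a)) ?_).trans ?_
    · intro n hn
      have := List.mem_range.1 hn
      simp only [esize_num]
      omega
    · gcongr
      simp only [esize_num, List.length_range]
      omega
  · rw [key]

@[fun_prop]
theorem drop {f : α → ℕ} {l : α → List β} (hf : PTime f) (hl : PTime l) :
    PTime fun a => (l a).drop (f a) := by
  have key : ∀ (i : ℕ) (l : List β), List.tail^[i] l = l.drop i := by
    intro i l
    induction i with
    | zero => simp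
    | succ i ih => rw [Function.iterate_succ_apply', ih, List.tail_drop]
  refine (iterate (f := fun _ => List.tail) hf hl (by fun_prop) hl.size ?_).of_enc fun a => ?_
  · intro a i _
    rw [key]
    exact esize_le_of_sublist (List.drop_sublist _ _)
  · rw [key]

/-- The number of choices can be exponential in the length of `l a`, so a bound on it, for all
suffixes met by the fold, has to be assumed. -/
theorem sections {l : α → List (List β)} (hl : PTime l) {B : α → ℕ} (hB : PolyBdd B)
    (h : ∀ a l', l' <:+ l a → l'.sections.length ≤ B a) : PTime fun a => (l a).sections := by
  have key : ∀ l : List (List β),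
      l.foldr (fun x L => L.flatMap fun s => x.map fun b => b :: s) [[]] = l.sections := by
    intro l
    induction l with
    | nil => rfl
    | cons x l ih => rw [List.foldr_cons, ih]; rfl
  refine (foldr (s := fun _ => [[]])
    (f := fun _ x (L : List (List β)) => L.flatMap fun s => x.map fun b => b :: s) hl (by fun_prop)
    (by fun_prop) (B := fun a => B a * (esize (l a) * (esize (l a) + 1) + 1 + 1) + 1)
    ((hB.mul (((hl.size.mul (hl.size.add (.const 1))).add (.const 1)).add (.const 1))).add
      (.const 1)) ?_).of_enc fun a => ?_
  · intro a l' hl'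
    rw [key]
    refine (esize_le_of_forall (B := esize (l a) * (esize (l a) + 1) + 1) ?_).trans ?_
    · intro s hs
      have hs := List.mem_sections.1 hs
      refine (esize_le_of_forall (B := esize (l a)) ?_).trans ?_
      · intro b hb
        obtain ⟨i, hi, rfl⟩ := List.getElem_of_mem hb
        have h1 := hs.get hi (by rw [← hs.length_eq]; exact hi)
        have h2 := hl'.subset (List.getElem_mem (by rw [← hs.length_eq]; exact hi : i < l'.length))
        exact (esize_le_of_mem h1).trans (esize_le_of_mem h2)
      · gcongr
        rw [hs.length_eq]
        exact hl'.length_le.trans (length_le_esize _)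
    · gcongr
      exact h a l' hl'
  · rw [key]

end PTime
end StackProg

/-! ### The decision procedure -/

namespace LCP
open StackProg
open Enc (enc)

/-! #### Reading a theory under an assignment -/

/-- Ground atoms as trees. -/
def mkAtom (tag : ℕ) (x y : Tr) : Tr := .node (enc tag) (.node x y)

/-- A tuple as a list of trees. -/
def tupleTr {N : ℕ} {τ : Type} (f : τ → Tr) (s : Fin N → τ) : List Tr := List.ofFn fun i => f (s i)

/-- A head as a tree, given trees for its arguments. -/
def Head.tr {N : ℕ} {τ : Type} (f : τ → Tr) : Head N τ → Tr
  | .pref s t => mkAtom 0 (enc (tupleTr f s)) (enc (tupleTr f t))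
  | .outcome s => mkAtom 1 (enc (tupleTr f s)) .leaf
  | .user p args => mkAtom 2 (enc p) (enc (args.map f))

/-- An atom as a tree, given trees for its arguments. -/
def Atom.tr {N : ℕ} {τ : Type} (f : τ → Tr) : Atom N τ → Tr
  | .ofHead h => h.tr f
  | .feature i t => mkAtom 3 (enc (i : ℕ)) (f t)
  | .dom s t => mkAtom 4 (enc (tupleTr f s)) (enc (tupleTr f t))

/-- Assignments of values to variables. -/
abbrev Assign : Type := List (Tr × Tr)

/-- The value of a variable. -/
def lookup (ρ : Assign) (v : Tr) : Tr :=
  ρ.foldr (fun p r => bif decide (p.1 = v) then p.2 else r) .leaf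

/-- The value of a term. -/
def Term.tr {K : ℕ} (ρ : Assign) : Term K → Tr
  | .var v => lookup ρ (enc v)
  | .const c => enc (c : ℕ)

/-- The truth value of a constraint. -/
def Constraint.truth {K : ℕ} (ρ : Assign) : Constraint K → Bool
  | .true => Bool.true
  | .eq t u => decide (t.tr ρ = u.tr ρ)
  | .not c => !c.truth ρ
  | .and c e => c.truth ρ && e.truth ρ
  | .or c e => c.truth ρ || e.truth ρ

/-- A ground rule: a head, the truth value of a constraint, and a list of goals. -/
abbrev Rule : Type := Tr × Bool × List Tr

/-- The instance of a clause. -/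
def Clause.rule {N K : ℕ} (ρ : Assign) (C : Clause N K) : Rule :=
  (C.head.tr (Term.tr ρ), C.constraint.truth ρ, C.body.map (Atom.tr (Term.tr ρ)))

/-- Entries of the stack of the reader; constraints are marked. -/
abbrev Entry : Type := Bool × Tr

/-- An entry of the stack of the reader. -/
def nth (st : List Entry) (i : ℕ) : Entry := (st.drop i).headD (false, .leaf)

/-- The reader processes a word from right to left; every symbol acts as an operator on a stack. -/
def readStep (ρ : Assign) (x : Symb) (st : List Entry) : List Entry :=
  match x with
  -- Horner's rule: from right to left the most significant digit comes first.
  | .bit b => (false, enc (2 * (nth st 0).2.spine + bif b then 1 else 0)) :: st.drop 1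
  -- The leaf is both the number zero and the empty list, the two things that `close` may begin from
  -- the right.
  | .close => (false, .leaf) :: st
  | .item =>
    -- A clause has no symbol of its own. A marked constraint in second place shows that the list
    -- element is a clause, made of the three topmost entries.
    bif (nth st 1).1 then
      (false, .node (.node (nth st 0).2 (.node (nth st 1).2 (nth st 2).2)) (nth st 3).2) ::
        st.drop 4
    else (false, .node (nth st 0).2 (nth st 1).2) :: st.drop 2
  | .var => (false, lookup ρ (nth st 0).2) :: st.drop 1
  | .const => st
  | .true => (true, enc true) :: st
  | .eq => (true, enc (decide ((nth st 0).2 = (nth st 1).2))) :: st.drop 2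
  | .not => (true, enc (decide ((nth st 0).2 = .leaf))) :: st.drop 1
  | .and => (true, enc (!decide ((nth st 0).2 = .leaf) && !decide ((nth st 1).2 = .leaf))) ::
      st.drop 2
  | .or => (true, enc (!decide ((nth st 0).2 = .leaf) || !decide ((nth st 1).2 = .leaf))) ::
      st.drop 2
  | .pref => (false, mkAtom 0 (nth st 0).2 (nth st 1).2) :: st.drop 2
  | .outcome => (false, mkAtom 1 (nth st 0).2 .leaf) :: st.drop 1
  | .user => (false, mkAtom 2 (nth st 0).2 (nth st 1).2) :: st.drop 2
  | .feature => (false, mkAtom 3 (nth st 0).2 (nth st 1).2) :: st.drop 2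
  | .dom => (false, mkAtom 4 (nth st 0).2 (nth st 1).2) :: st.drop 2

/-- Read a word. -/
def read (ρ : Assign) (w : List Symb) (st : List Entry) : List Entry := w.foldr (readStep ρ) st

section
variable (ρ : Assign) (st : List Entry)

theorem read_nil : read ρ [] st = st := rfl

theorem read_cons (x : Symb) (w : List Symb) :
    read ρ (x :: w) st = readStep ρ x (read ρ w st) := rfl

theorem read_append (w w' : List Symb) : read ρ (w ++ w') st = read ρ w (read ρ w' st) :=
  List.foldr_append

theorem read_encNat (n : ℕ) : read ρ (encNat n) st = (false, enc n) :: st := by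
  rw [encNat, read_append]
  induction n using Nat.binaryRec' with
  | zero => simp [read, readStep]
  | bit b n h ih =>
    rw [Nat.bits_append_bit n b h, List.map_cons, read_cons, ih]
    cases b <;> simp [readStep, nth, Nat.bit]

theorem read_encFin {n : ℕ} (i : Fin n) : read ρ (encFin i) st = (false, enc (i : ℕ)) :: st :=
  read_encNat ρ st i

theorem read_encList {α : Type} {e : α → List Symb} {g : α → Tr}
    (h : ∀ a st, read ρ (e a) st = (false, g a) :: st) (l : List α) :
    read ρ (encList e l) st = (false, enc (l.map g)) :: st := by
  induction l with
  | nil => rfl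
  | cons a l ih =>
    rw [encList, read_cons, read_append, ih, h]
    rfl

theorem read_encTuple {n : ℕ} {α : Type} {e : α → List Symb} {g : α → Tr}
    (h : ∀ a st, read ρ (e a) st = (false, g a) :: st) (f : Fin n → α) :
    read ρ (encTuple e f) st = (false, enc (tupleTr g f)) :: st := by
  rw [encTuple, read_encList ρ st h, List.map_ofFn]
  rfl

variable {N K : ℕ}

theorem read_encTerm (t : Term K) : read ρ (encTerm t) st = (false, t.tr ρ) :: st := by
  cases t with
  | var v => rw [encTerm, read_cons, read_encNat]; rfl
  | const c => rw [encTerm, read_cons, read_encFin]; rfl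

theorem read_encConstraint (c : Constraint K) :
    read ρ (encConstraint c) st = (true, enc (c.truth ρ)) :: st := by
  induction c generalizing st with
  | true => rfl
  | eq t u => rw [encConstraint, read_cons, read_append, read_encTerm, read_encTerm]; rfl
  | not c ih =>
    rw [encConstraint, read_cons, ih]
    cases h : c.truth ρ <;> simp [readStep, nth, Constraint.truth, h]
  | and c e ih ih' =>
    rw [encConstraint, read_cons, read_append, ih', ih]
    cases h : c.truth ρ <;> cases h' : e.truth ρ <;>
      simp [readStep, nth, Constraint.truth, h, h']
  | or c e ih ih' =>
    rw [encConstraint, read_cons, read_append, ih', ih]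
    cases h : c.truth ρ <;> cases h' : e.truth ρ <;>
      simp [readStep, nth, Constraint.truth, h, h']

theorem read_encHead (h : Head N (Term K)) :
    read ρ (encHead h) st = (false, h.tr (Term.tr ρ)) :: st := by
  have ht := fun (st : List Entry) (s : Fin N → Term K) =>
    read_encTuple ρ st (e := encTerm) (fun t st => read_encTerm ρ st t) s
  cases h with
  | pref s t => rw [encHead, read_cons, read_append, ht, ht]; rfl
  | outcome s => rw [encHead, read_cons, ht]; rfl
  | user p args =>
    rw [encHead, read_cons, read_append,
      read_encList ρ st (fun t st => read_encTerm ρ st t), read_encNat]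
    rfl

theorem read_encAtom (A : Atom N (Term K)) :
    read ρ (encAtom A) st = (false, A.tr (Term.tr ρ)) :: st := by
  have ht := fun (st : List Entry) (s : Fin N → Term K) =>
    read_encTuple ρ st (e := encTerm) (fun t st => read_encTerm ρ st t) s
  cases A with
  | ofHead h => exact read_encHead ρ st h
  | feature i t => rw [encAtom, read_cons, read_append, read_encTerm, read_encFin]; rfl
  | dom s t => rw [encAtom, read_cons, read_append, ht, ht]; rfl

theorem read_encClauses (l : List (Clause N K)) :
    read ρ (encList encClause l) st = (false, enc (l.map (Clause.rule ρ))) :: st := by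
  induction l with
  | nil => rfl
  | cons C l ih =>
    rw [encList, read_cons, read_append, ih, encClause, read_append, read_append,
      read_encList ρ _ (fun A st => read_encAtom ρ st A), read_encConstraint, read_encHead]
    rfl

/-- The values of the features. -/
def OptInput.values (I : OptInput) : List (List Tr) :=
  List.ofFn fun i => (I.theory.values i).map fun c : Fin I.K => enc (c : ℕ)

/-- The instances of the clauses. -/
def OptInput.ground (I : OptInput) (ρ : Assign) : List Rule := I.theory.clauses.map (Clause.rule ρ)

/-- The queried tuple. -/
def OptInput.goal (I : OptInput) : List Tr := tupleTr (fun c : Fin I.K => enc (c : ℕ)) I.query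

theorem enc_map_enc {α : Type} [Enc α] (l : List α) : enc (l.map enc) = enc l := by
  induction l with
  | nil => rfl
  | cons a l ih => rw [List.map_cons, enc_cons, ih]; rfl

theorem read_encInput (I : OptInput) : read ρ (encInput I) [] =
    [(false, enc I.N), (false, enc I.K), (false, enc I.values), (false, enc (I.ground ρ)),
      (false, enc I.goal)] := by
  have h1 : ∀ (i : Fin I.K) (st : List Entry),
      read ρ (encFin i) st = (false, enc (i : ℕ)) :: st := fun i st => read_encFin ρ st i
  rw [encInput, read_append, read_append, read_append, read_append,
    read_encTuple ρ _ h1, read_encClauses,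
    read_encTuple ρ _ (fun l st => read_encList ρ st h1 l), read_encNat, read_encNat]
  have h2 : enc I.values = enc (I.values.map enc) := (enc_map_enc _).symm
  rw [h2, OptInput.values, List.map_ofFn]
  rfl

end

/-! ### Growth of the reader's stack. -/

theorem _root_.Tr.two_mul_spine_lt_size : (x : Tr) → 2 * x.spine < x.size
  | .leaf => Nat.one_pos
  | .node x y => by
    have := two_mul_spine_lt_size y
    have := x.size_pos
    simp only [Tr.spine, Tr.size]
    omega

theorem esize_lookup_le (ρ : Assign) (v : Tr) : esize (lookup ρ v) ≤ esize ρ := by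
  induction ρ with
  | nil => simp [lookup, esize]
  | cons p ρ ih =>
    rw [lookup, List.foldr_cons, ← lookup]
    cases decide (p.1 = v)
    · simp only [cond_false, esize_cons]; omega
    · simp only [cond_true, esize_cons, esize_pair]; omega

/-- The factor `2` comes from binary digits, which double numbers held in unary; the summand `esize
ρ` comes from looking up a variable. All other symbols add only a constant. -/
theorem esize_readStep_le (ρ : Assign) (x : Symb) (st : List Entry) :
    esize (readStep ρ x st) ≤ 2 * esize st + esize ρ + 40 := by
  have h1 : ∀ x y : Tr, esize (Tr.node x y) = esize x + esize y + 1 := fun _ _ => rfl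
  have h2 : esize Tr.leaf = 1 := rfl
  have h3 := fun v => esize_lookup_le ρ v
  have h4 : ∀ x : Tr, 2 * x.spine < esize x := Tr.two_mul_spine_lt_size
  have h5 := esize_bool_le
  have h6 : ∀ b : Bool, esize (enc b) = esize b := esize_enc
  have h7 : ∀ n : ℕ, esize (enc n) = 2 * n + 1 := fun n => (esize_enc n).trans (esize_num n)
  -- The `3` pays for the default entry when the stack is too short.
  have h8 : ∀ i, esize (nth st i) + esize (st.drop (i + 1)) ≤ esize (st.drop i) + 3 := by
    intro i
    rw [nth, ← List.tail_drop]
    cases st.drop i <;> simp [h2]; omega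
  have h9 : ∀ i, esize (nth st i) = esize (nth st i).1 + esize (nth st i).2 + 1 := fun i => rfl
  have e0 := h8 0
  have e1 := h8 1
  have e2 := h8 2
  have e3 := h8 3
  have p0 := esize_pos (nth st 0).1
  have p1 := esize_pos (nth st 1).1
  have p2 := esize_pos (nth st 2).1
  have p3 := esize_pos (nth st 3).1
  simp only [h9, List.drop_zero] at e0 e1 e2 e3
  simp only [zero_add, Nat.reduceAdd] at e0 e1 e2 e3
  cases x with
  | bit b =>
    have := h4 (nth st 0).2
    cases b <;>
      simp only [readStep, esize_cons, esize_pair, esize_false, h7, cond_true, cond_false] <;> omega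
  | item =>
    simp only [readStep]
    cases (nth st 1).1 <;>
      simp only [cond_true, cond_false, esize_cons, esize_pair, h1, esize_false] <;> omega
  | var =>
    have := h3 (nth st 0).2
    simp only [readStep, esize_cons, esize_pair, esize_false]; omega
  | const => simp only [readStep]; omega
  | close => simp only [readStep, esize_cons, esize_pair, esize_false, h2]; omega
  | true => simp only [readStep, esize_cons, esize_pair, esize_true, h6]; omega
  | eq =>
    have := h5 (decide ((nth st 0).2 = (nth st 1).2))
    simp only [readStep, esize_cons, esize_pair, esize_true, h6]; omega
  | not =>
    have := h5 (decide ((nth st 0).2 = .leaf))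
    simp only [readStep, esize_cons, esize_pair, esize_true, h6]; omega
  | and =>
    have := h5 (!decide ((nth st 0).2 = .leaf) && !decide ((nth st 1).2 = .leaf))
    simp only [readStep, esize_cons, esize_pair, esize_true, h6]; omega
  | or =>
    have := h5 (!decide ((nth st 0).2 = .leaf) || !decide ((nth st 1).2 = .leaf))
    simp only [readStep, esize_cons, esize_pair, esize_true, h6]; omega
  | _ =>
    simp only [readStep, esize_cons, esize_pair, esize_false, mkAtom, h1, h2, h7]
    omega

theorem esize_read_le (ρ : Assign) (w : List Symb) :
    esize (read ρ w []) ≤ 2 ^ w.length * (esize ρ + 41) := by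
  -- With `esize ρ + 40` added, the quantity at most doubles with each symbol.
  have h : esize (read ρ w []) + esize ρ + 40 ≤ 2 ^ w.length * (esize ρ + 41) := by
    induction w with
    | nil => rw [read_nil]; simp; omega
    | cons x w ih =>
      have := esize_readStep_le ρ x (read ρ w [])
      rw [read_cons, List.length_cons, pow_succ, mul_right_comm]
      omega
  omega

/-! #### The algorithm -/

/-- The padding of an input. -/
def OptInput.pad (I : OptInput) : ℕ := 2 ^ ((encInput I).length * ((encInput I).length + 1))

noncomputable instance : Enc Symb :=
  ⟨fun x => enc (Fintype.equivFin Symb x : ℕ), fun _ _ h =>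
    (Fintype.equivFin Symb).injective (Fin.ext (Enc.inj h))⟩

theorem esize_symb_le (x : Symb) : esize x ≤ 2 * Fintype.card Symb + 1 := by
  have h : esize x = esize (Fintype.equivFin Symb x : ℕ) := rfl
  have := (Fintype.equivFin Symb x).isLt
  rw [h, esize_num]
  omega

/-- Inputs are represented by their words, reversed, together with a padding. -/
noncomputable instance : Enc OptInput :=
  ⟨fun I => enc ((encInput I).reverse, I.pad), fun _ _ h =>
    encInput_injective (List.reverse_injective (congrArg Prod.fst (Enc.inj h)))⟩

/-- Trees that occur on top of the stack of the reader, among them all variables. -/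
def OptInput.names (I : OptInput) : List Tr :=
  (List.range ((encInput I).length + 1)).map fun i => (nth (read [] ((encInput I).drop i) []) 0).2

/-- The constants. -/
def OptInput.consts (I : OptInput) : List Tr := (List.range I.K).map fun c => enc c

/-- The assignments of constants to the variables. -/
def OptInput.assigns (I : OptInput) : List Assign :=
  (I.names.map fun v => I.consts.map fun c => (v, c)).sections

/-- The tuples of constants. -/
def OptInput.tuples (I : OptInput) : List (List Tr) :=
  ((List.range I.N).map fun _ => I.consts).sections

/-- The rules for the domain predicates. -/
def OptInput.featureRules (I : OptInput) : List Rule :=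
  (List.range I.N).flatMap fun i =>
    ((I.values.drop i).headD []).map fun c => (mkAtom 3 (enc i) c, true, [])

/-- The rules for dominance. -/
def OptInput.domRules (I : OptInput) : List Rule :=
  I.tuples.flatMap fun x => I.tuples.flatMap fun y =>
    (mkAtom 4 (enc x) (enc y), true,
      [mkAtom 0 (enc x) (enc y), mkAtom 1 (enc x) .leaf, mkAtom 1 (enc y) .leaf]) ::
    I.tuples.map fun z => (mkAtom 4 (enc x) (enc y), true,
      [mkAtom 0 (enc x) (enc z), mkAtom 4 (enc z) (enc y)])

/-- All ground rules. -/
def OptInput.rules (I : OptInput) : List Rule :=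
  (I.assigns.flatMap fun ρ => I.ground ρ) ++ (I.featureRules ++ I.domRules)

/-- Membership in a list of trees. -/
def isIn (t : Tr) (S : List Tr) : Bool := S.any fun s => decide (s = t)

/-- The rules that can be applied to a list of facts. -/
def firing (R : List Rule) (S : List Tr) : List Rule :=
  R.filter fun r => r.2.1 && r.2.2.all fun b => isIn b S

/-- The immediate consequences of a list of facts. -/
def hornStep (R : List Rule) (S : List Tr) : List Tr := (firing R S).map fun r => r.1

/-- The consequences of a list of rules. -/
def hornClosure (R : List Rule) : List Tr := (hornStep R)^[R.length + 1] []

/-- Decide optimality, given the true facts, the tuples of constants, and the query. -/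
def optimalIn (S : List Tr) (T : List (List Tr)) (s : List Tr) : Bool :=
  isIn (mkAtom 1 (enc s) .leaf) S && T.all fun t =>
    decide (t = s) || (!isIn (mkAtom 1 (enc t) .leaf) S || !isIn (mkAtom 4 (enc t) (enc s)) S)

/-- The decision procedure. -/
def OptInput.decideOptimal (I : OptInput) : Bool := optimalIn (hornClosure I.rules) I.tuples I.goal

end LCP

namespace LCP
open StackProg
open Enc (enc)

/-! #### The decision procedure runs in polynomial time on padded inputs -/

section
variable {α : Type} [Enc α]

@[fun_prop]
theorem ptime_mkAtom {tag : ℕ} {f g : α → Tr} (hf : PTime f) (hg : PTime g) :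
    PTime fun a => mkAtom tag (f a) (g a) := by
  unfold mkAtom
  fun_prop

@[fun_prop]
theorem ptime_nth {f : α → List Entry} {i : ℕ} (hf : PTime f) : PTime fun a => nth (f a) i := by
  unfold nth
  fun_prop

@[fun_prop]
theorem ptime_lookup {f : α → Assign} {g : α → Tr} (hf : PTime f) (hg : PTime g) :
    PTime fun a => lookup (f a) (g a) := by
  have hg' := hg.comp (PTime.fst' (α := α) (β := (Tr × Tr) × Tr))
  exact PTime.foldr (f := fun a (p : Tr × Tr) r => bif decide (p.1 = g a) then p.2 else r) hf
    (PTime.const Tr.leaf) (by fun_prop) hf.size fun a l' h =>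
    (esize_lookup_le l' (g a)).trans (esize_le_of_sublist h.sublist)

attribute [fun_prop] PTime.spine

theorem ptime_readStep : PTime fun p : Assign × Symb × List Entry => readStep p.1 p.2.1 p.2.2 := by
  refine PTime.finCases (f := fun x (p : Assign × Symb × List Entry) => readStep p.1 x p.2.2)
    (by fun_prop) fun x => ?_
  cases x with
  | bit b => cases b <;> (simp only [readStep]; fun_prop)
  | _ => simp only [readStep]; fun_prop

/-- Reading may produce numbers exponential in the length of the word; the hypothesis `hB` says that
the argument is padded enough to pay for them. -/
theorem ptime_read {ρ : α → Assign} {w : α → List Symb} (hρ : PTime ρ) (hw : PTime w)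
    (hB : PolyBdd fun a => 2 ^ (w a).length) : PTime fun a => read (ρ a) (w a) [] := by
  have hρ' := hρ.comp (PTime.fst' (α := α) (β := Symb × List Entry))
  refine PTime.foldr (f := fun a => readStep (ρ a)) hw (PTime.const [])
    (ptime_readStep.comp (f := fun p : α × Symb × List Entry => (ρ p.1, p.2.1, p.2.2))
      (by fun_prop)) (hB.mul (hρ.size.add (.const 41))) fun a w' h => ?_
  refine (esize_read_le (ρ a) w').trans (Nat.mul_le_mul_right _ ?_)
  exact Nat.pow_le_pow_right (by norm_num) h.length_le

@[fun_prop]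
theorem ptime_isIn {f : α → Tr} {g : α → List Tr} (hf : PTime f) (hg : PTime g) :
    PTime fun a => isIn (f a) (g a) := by
  have hf' := hf.comp (PTime.fst' (α := α) (β := Tr))
  unfold isIn
  fun_prop

@[fun_prop]
theorem ptime_firing {f : α → List Rule} {g : α → List Tr} (hf : PTime f) (hg : PTime g) :
    PTime fun a => firing (f a) (g a) := by
  have hg' := (hg.comp (PTime.fst' (α := α) (β := Rule))).comp
    (PTime.fst' (α := α × Rule) (β := Tr))
  unfold firing
  fun_prop

@[fun_prop]
theorem ptime_hornStep {f : α → List Rule} {g : α → List Tr} (hf : PTime f) (hg : PTime g) :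
    PTime fun a => hornStep (f a) (g a) := by
  unfold hornStep
  fun_prop

theorem esize_map_fst_le {β γ : Type} [Enc β] [Enc γ] (l : List (β × γ)) :
    esize (l.map fun p => p.1) ≤ esize l := by
  induction l with
  | nil => exact le_rfl
  | cons p l ih => simp only [List.map_cons, esize_cons, esize_pair]; omega

@[fun_prop]
theorem ptime_hornClosure {f : α → List Rule} (hf : PTime f) :
    PTime fun a => hornClosure (f a) := by
  have hf' := hf.comp (PTime.fst' (α := α) (β := List Tr))
  -- Every stage lists the heads of a sublist of the rules, so the size of the rules bounds all
  -- stages.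
  refine PTime.iterate (n := fun a => (f a).length + 1) (s := fun _ => [])
    (f := fun a => hornStep (f a)) (by fun_prop) (by fun_prop) (by fun_prop) hf.size ?_
  intro a i _
  cases i with
  | zero => exact esize_pos (f a)
  | succ i =>
    rw [Function.iterate_succ_apply']
    exact (esize_map_fst_le _).trans (esize_le_of_sublist List.filter_sublist)

end

/-! ### Numbers of constants, assignments and tuples against the padded size. -/

section
variable (I : OptInput)

theorem esize_input : esize I = esize (encInput I).reverse + (2 * I.pad + 1) + 1 := by
  rw [← esize_num]
  rfl

theorem two_pow_le_esize_input : 2 ^ (encInput I).length ≤ esize I := by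
  have h : 2 ^ (encInput I).length ≤ I.pad := by
    refine Nat.pow_le_pow_right (by norm_num) ?_
    nlinarith [Nat.zero_le (encInput I).length]
  rw [esize_input]
  omega

theorem length_encList {α : Type} (e : α → List Symb) (l : List α) :
    l.length ≤ (encList e l).length := by
  induction l with
  | nil => simp
  | cons a l ih => simp only [encList, List.length_cons, List.length_append]; omega

theorem features_le : I.N ≤ (encInput I).length := by
  have h := length_encList encFin (List.ofFn I.query)
  simp only [List.length_ofFn] at h
  simp only [encInput, encTuple, List.length_append]
  omega

theorem constants_le : I.K ≤ 2 ^ (encInput I).length := by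
  refine (Nat.lt_size_self I.K).le.trans (Nat.pow_le_pow_right (by norm_num) ?_)
  rw [← Nat.size_eq_bits_len]
  simp only [encInput, encNat, List.length_append, List.length_map]
  omega

theorem length_sections_le {β : Type} {L : List (List β)} {k : ℕ} (h : ∀ l ∈ L, l.length ≤ k) :
    L.sections.length ≤ k ^ L.length := by
  induction L with
  | nil => simp
  | cons l L ih =>
    have h1 := ih fun l' hl' => h l' (List.mem_cons_of_mem _ hl')
    have h2 := h l List.mem_cons_self
    have h3 : ∀ S : List (List β), (S.flatMap fun s => l.map fun a => a :: s).length =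
        S.length * l.length := by
      intro S
      induction S with
      | nil => simp
      | cons s S ih => simp [ih, add_one_mul, add_comm]
    rw [List.sections, List.length_cons, pow_succ]
    exact (h3 _).trans_le (Nat.mul_le_mul h1 h2)

/-- This estimate dictates the padding: `K ≤ 2 ^ n` gives `K ^ (n + 1) ≤ 2 ^ (n * (n + 1))`. The
exponent `n + 1` is the number of suffixes of the word, which are the sources of variable names. -/
theorem constants_pow_le {m : ℕ} (h : m ≤ (encInput I).length + 1) : I.K ^ m ≤ esize I := by
  have h1 : I.K ^ m ≤ I.pad := by
    calc I.K ^ m ≤ I.K ^ ((encInput I).length + 1) :=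
          Nat.pow_le_pow_right I.theory.constants_pos h
      _ ≤ (2 ^ (encInput I).length) ^ ((encInput I).length + 1) :=
          Nat.pow_le_pow_left (constants_le I) _
      _ = I.pad := by rw [← pow_mul, OptInput.pad]
  rw [esize_input]
  omega

end

@[fun_prop]
theorem ptime_word : PTime encInput := by
  have h : PTime fun I : OptInput => ((encInput I).reverse, I.pad) := PTime.id.of_enc fun _ => rfl
  simpa using h.fst.reverse

theorem ptime_read_input {α : Type} [Enc α] {ρ : α → Assign} {I : α → OptInput} (hρ : PTime ρ)
    (hI : PTime I) : PTime fun a => read (ρ a) (encInput (I a)) [] :=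
  ptime_read hρ (ptime_word.comp hI) (hI.size.of_le fun a => two_pow_le_esize_input (I a))

@[fun_prop]
theorem ptime_features : PTime OptInput.N := by
  have h := ptime_read_input (ρ := fun _ => []) (I := fun I => I) (PTime.const []) PTime.id
  refine (ptime_nth (i := 0) h).snd.of_enc fun I => ?_
  rw [read_encInput]; rfl

@[fun_prop]
theorem ptime_constants : PTime OptInput.K := by
  have h := ptime_read_input (ρ := fun _ => []) (I := fun I => I) (PTime.const []) PTime.id
  refine (ptime_nth (i := 1) h).snd.of_enc fun I => ?_
  rw [read_encInput]; rfl

@[fun_prop]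
theorem ptime_values : PTime OptInput.values := by
  have h := ptime_read_input (ρ := fun _ => []) (I := fun I => I) (PTime.const []) PTime.id
  refine (ptime_nth (i := 2) h).snd.of_enc fun I => ?_
  rw [read_encInput]; rfl

@[fun_prop]
theorem ptime_goal : PTime OptInput.goal := by
  have h := ptime_read_input (ρ := fun _ => []) (I := fun I => I) (PTime.const []) PTime.id
  refine (ptime_nth (i := 4) h).snd.of_enc fun I => ?_
  rw [read_encInput]; rfl

/-- The instances are obtained by reading the word afresh under each assignment. -/
theorem ptime_ground : PTime fun p : OptInput × Assign => p.1.ground p.2 := by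
  have h := ptime_read_input (ρ := fun p : OptInput × Assign => p.2) (I := fun p => p.1)
    (by fun_prop) (by fun_prop)
  refine (ptime_nth (i := 3) h).snd.of_enc fun p => ?_
  rw [read_encInput]; rfl

@[fun_prop]
theorem ptime_names : PTime OptInput.names := by
  have h : PTime fun p : OptInput × ℕ => read [] ((encInput p.1).drop p.2) [] := by
    refine ptime_read (ρ := fun _ => []) (by fun_prop) (by fun_prop)
      ((PTime.fst' (α := OptInput) (β := ℕ)).size.of_le fun p => ?_)
    refine le_trans (Nat.pow_le_pow_right (by norm_num) ?_) (two_pow_le_esize_input p.1)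
    simp
  unfold OptInput.names
  fun_prop

@[fun_prop]
theorem ptime_consts : PTime OptInput.consts := by
  unfold OptInput.consts
  fun_prop

theorem length_consts (I : OptInput) : I.consts.length = I.K := by simp [OptInput.consts]

@[fun_prop]
theorem ptime_assigns : PTime OptInput.assigns := by
  unfold OptInput.assigns
  refine PTime.sections (by fun_prop) PolyBdd.size fun I l' h => ?_
  refine (length_sections_le (k := I.K) fun l hl => ?_).trans (constants_pow_le I ?_)
  · obtain ⟨v, -, rfl⟩ := List.mem_map.1 (h.subset hl)
    simp [length_consts]
  · refine h.length_le.trans ?_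
    simp [OptInput.names]

@[fun_prop]
theorem ptime_tuples : PTime OptInput.tuples := by
  unfold OptInput.tuples
  refine PTime.sections (by fun_prop) PolyBdd.size fun I l' h => ?_
  refine (length_sections_le (k := I.K) fun l hl => ?_).trans (constants_pow_le I ?_)
  · obtain ⟨v, -, rfl⟩ := List.mem_map.1 (h.subset hl)
    simp [length_consts]
  · refine h.length_le.trans ?_
    have := features_le I
    simp
    omega

@[fun_prop]
theorem ptime_featureRules : PTime OptInput.featureRules := by
  unfold OptInput.featureRules
  fun_prop

@[fun_prop]
theorem ptime_domRules : PTime OptInput.domRules := by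
  unfold OptInput.domRules
  fun_prop

@[fun_prop]
theorem ptime_rules : PTime OptInput.rules := by
  have h := ptime_ground
  unfold OptInput.rules
  fun_prop

theorem ptime_decideOptimal : PTime OptInput.decideOptimal := by
  unfold OptInput.decideOptimal optimalIn
  fun_prop

end LCP

namespace LCP
open StackProg
open Enc (enc)

/-! #### Horn closure -/

/-- The least set of facts closed under a list of rules. -/
inductive Entails (R : List Rule) : Tr → Prop
  | intro (r : Rule) (hr : r ∈ R) (hc : r.2.1 = true) (hb : ∀ b ∈ r.2.2, Entails R b) :
      Entails R r.1

theorem isIn_iff {t : Tr} {S : List Tr} : isIn t S = true ↔ t ∈ S := by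
  simp [isIn]

theorem mem_firing {R : List Rule} {S : List Tr} {r : Rule} :
    r ∈ firing R S ↔ r ∈ R ∧ r.2.1 = true ∧ ∀ b ∈ r.2.2, b ∈ S := by
  simp [firing, isIn_iff]

theorem mem_hornStep {R : List Rule} {S : List Tr} {t : Tr} :
    t ∈ hornStep R S ↔ ∃ r ∈ R, (r.2.1 = true ∧ ∀ b ∈ r.2.2, b ∈ S) ∧ r.1 = t := by
  simp only [hornStep, List.mem_map, mem_firing, and_assoc]

theorem hornStep_mono (R : List Rule) {S T : List Tr} (h : S ⊆ T) :
    hornStep R S ⊆ hornStep R T := by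
  intro t
  simp only [mem_hornStep]
  rintro ⟨r, hr, ⟨hc, hb⟩, rfl⟩
  exact ⟨r, hr, ⟨hc, fun b hb' => h (hb b hb')⟩, rfl⟩

theorem firing_sublist (R : List Rule) {S T : List Tr} (h : S ⊆ T) :
    (firing R S).Sublist (firing R T) := by
  refine List.monotone_filter_right R fun r => ?_
  simp only [Bool.and_eq_true, List.all_eq_true, isIn_iff]
  exact fun hr => ⟨hr.1, fun b hb => h (hr.2 b hb)⟩

/-- The lists of applicable rules form an increasing chain of sublists of `R`. If no two consecutive
ones among the first `R.length + 2` agreed, their lengths would exceed `R.length`. Once two agree,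
the next stages agree as lists, and the iteration is constant from there on. -/
theorem hornStep_hornClosure (R : List Rule) : hornStep R (hornClosure R) = hornClosure R := by
  set S : ℕ → List Tr := fun i => (hornStep R)^[i] [] with hS
  have hsucc : ∀ i, S (i + 1) = hornStep R (S i) := fun i => Function.iterate_succ_apply' _ _ _
  have hmono : ∀ i, S i ⊆ S (i + 1) := by
    intro i
    induction i with
    | zero => simp [hS]
    | succ i ih => rw [hsucc i, hsucc (i + 1)]; exact hornStep_mono R ih
  have hstable : ∃ i ≤ R.length, firing R (S i) = firing R (S (i + 1)) := by
    by_contra! hne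
    have hlen : ∀ i ≤ R.length + 1, i ≤ (firing R (S i)).length := by
      intro i
      induction i with
      | zero => simp
      | succ i ih =>
        intro hi
        have h1 := ih (by omega)
        have h2 := firing_sublist R (hmono i)
        by_contra! h3
        exact hne i (by omega) (h2.eq_of_length_le (by omega))
    have h1 := hlen (R.length + 1) le_rfl
    have h2 : (firing R (S (R.length + 1))).length ≤ R.length := List.length_filter_le _ _
    omega
  obtain ⟨i, hi, he⟩ := hstable
  -- The fixed point is `S (i + 1)` rather than `S i`; hence the extra round in `hornClosure`.
  have hfix : hornStep R (S (i + 1)) = S (i + 1) := by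
    conv_rhs => rw [hsucc i]
    rw [hornStep, hornStep, he]
  have hconst : ∀ k, S (i + 1 + k) = S (i + 1) := by
    intro k
    induction k with
    | zero => rfl
    | succ k ih => rw [← add_assoc, hsucc, ih, hfix]
  have h1 : hornClosure R = S (i + 1) := by
    have := hconst (R.length - i)
    rwa [show i + 1 + (R.length - i) = R.length + 1 by omega] at this
  rw [h1, hfix]

theorem mem_hornClosure {R : List Rule} {t : Tr} : t ∈ hornClosure R ↔ Entails R t := by
  constructor
  · have h : ∀ i t, t ∈ (hornStep R)^[i] [] → Entails R t := by
      intro i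
      induction i with
      | zero => simp
      | succ i ih =>
        intro t
        rw [Function.iterate_succ_apply', mem_hornStep]
        rintro ⟨r, hr, ⟨hc, hb⟩, rfl⟩
        exact .intro r hr hc fun b hb' => ih b (hb b hb')
    exact h _ t
  · intro h
    induction h with
    | intro r hr hc hb ih =>
      rw [← hornStep_hornClosure, mem_hornStep]
      exact ⟨r, hr, ⟨hc, ih⟩, rfl⟩

/-! #### Ground atoms as trees -/

/-- The tree of a constant. -/
def constTr {K : ℕ} (c : Fin K) : Tr := enc (c : ℕ)

theorem constTr_injective {K : ℕ} : Function.Injective (constTr (K := K)) := fun _ _ h =>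
  Fin.ext (Enc.inj h)

theorem tupleTr_injective {N : ℕ} {τ : Type} {f : τ → Tr} (hf : Function.Injective f) :
    Function.Injective (tupleTr (N := N) f) := fun _ _ h =>
  funext fun i => hf (congrFun (List.ofFn_injective h) i)

theorem mkAtom_inj {m n : ℕ} {x y x' y' : Tr} :
    mkAtom m x y = mkAtom n x' y' ↔ m = n ∧ x = x' ∧ y = y' := by
  simp [mkAtom, Enc.inj.eq_iff]

theorem Atom.tr_injective {N : ℕ} {τ : Type} {f : τ → Tr} (hf : Function.Injective f) :
    Function.Injective (Atom.tr (N := N) f) := by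
  have ht := tupleTr_injective (N := N) hf
  intro A B h
  rcases A with (⟨s, t⟩ | ⟨s⟩ | ⟨p, l⟩) | ⟨i, c⟩ | ⟨s, t⟩ <;>
    rcases B with (⟨s', t'⟩ | ⟨s'⟩ | ⟨p', l'⟩) | ⟨i', c'⟩ | ⟨s', t'⟩ <;>
    simp [Atom.tr, Head.tr, mkAtom_inj, Enc.inj.eq_iff, ht.eq_iff, hf.eq_iff,
      (List.map_injective_iff.2 hf).eq_iff, Fin.val_inj] at h ⊢ <;> exact h

/-- The tree of a ground atom. -/
abbrev groundTr {N K : ℕ} (A : Atom N (Fin K)) : Tr := A.tr constTr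

section
variable {K : ℕ} {ρ : Assign} {σ : ℕ → Fin K}

/-- The assignments `ρ` and `σ` agree on a term. -/
def Agree (ρ : Assign) (σ : ℕ → Fin K) (t : Term K) : Prop := t.tr ρ = constTr (t.eval σ)

variable {w : List Symb}

theorem infix_left {u v : List Symb} (h : u ++ v <:+: w) : u <:+: w :=
  (List.prefix_append u v).isInfix.trans h

theorem infix_right {u v : List Symb} (h : u ++ v <:+: w) : v <:+: w :=
  (List.suffix_append u v).isInfix.trans h

theorem infix_tail {x : Symb} {v : List Symb} (h : x :: v <:+: w) : v <:+: w :=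
  (List.suffix_cons x v).isInfix.trans h

theorem infix_of_mem {α : Type} {e : α → List Symb} {l : List α} (h : encList e l <:+: w) {a : α}
    (ha : a ∈ l) : e a <:+: w := by
  induction l with
  | nil => simp at ha
  | cons b l ih =>
    rw [encList] at h
    rcases List.mem_cons.1 ha with rfl | ha
    · exact infix_left (infix_tail h)
    · exact ih (infix_right (infix_tail h)) ha

variable {N : ℕ}

theorem tupleTr_of_agree (h : ∀ t : Term K, encTerm t <:+: w → Agree ρ σ t)
    {s : Fin N → Term K} (hs : encTuple encTerm s <:+: w) :
    tupleTr (Term.tr ρ) s = tupleTr constTr (Term.eval σ ∘ s) := by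
  rw [tupleTr, tupleTr]
  congr 1
  funext i
  exact h (s i) (infix_of_mem hs ((List.mem_ofFn' _ _).2 ⟨i, rfl⟩))

theorem head_tr_of_agree (h : ∀ t : Term K, encTerm t <:+: w → Agree ρ σ t)
    {H : Head N (Term K)} (hH : encHead H <:+: w) :
    H.tr (Term.tr ρ) = (H.map (Term.eval σ)).tr constTr := by
  cases H with
  | pref s t =>
    have h1 := tupleTr_of_agree h (infix_left (infix_tail hH))
    have h2 := tupleTr_of_agree h (infix_right (infix_tail hH))
    simp only [Head.tr, Head.map, h1, h2]
  | outcome s =>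
    have h1 := tupleTr_of_agree h (infix_tail hH)
    simp only [Head.tr, Head.map, h1]
  | user p args =>
    have h1 : args.map (Term.tr ρ) = (args.map (Term.eval σ)).map constTr := by
      rw [List.map_map]
      exact List.map_congr_left fun t ht => h t (infix_of_mem (infix_right (infix_tail hH)) ht)
    simp only [Head.tr, Head.map, h1]

theorem atom_tr_of_agree (h : ∀ t : Term K, encTerm t <:+: w → Agree ρ σ t)
    {A : Atom N (Term K)} (hA : encAtom A <:+: w) :
    A.tr (Term.tr ρ) = groundTr (A.map (Term.eval σ)) := by
  cases A with
  | ofHead H => exact head_tr_of_agree h hA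
  | feature i t =>
    have h1 : t.tr ρ = _ := h t (infix_right (infix_tail hA))
    simp only [groundTr, Atom.tr, Atom.map, h1]
  | dom s t =>
    have h1 := tupleTr_of_agree h (infix_left (infix_tail hA))
    have h2 := tupleTr_of_agree h (infix_right (infix_tail hA))
    simp only [groundTr, Atom.tr, Atom.map, h1, h2]

theorem truth_of_agree (h : ∀ t : Term K, encTerm t <:+: w → Agree ρ σ t)
    {c : Constraint K} (hc : encConstraint c <:+: w) :
    c.truth ρ = true ↔ c.Holds σ := by
  induction c with
  | true => simp [Constraint.truth, Constraint.Holds]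
  | eq t u =>
    have h1 : t.tr ρ = _ := h t (infix_left (infix_tail hc))
    have h2 : u.tr ρ = _ := h u (infix_right (infix_tail hc))
    simp [Constraint.truth, Constraint.Holds, h1, h2, constTr_injective.eq_iff]
  | not c ih =>
    have h1 := ih (infix_tail hc)
    simp [Constraint.truth, Constraint.Holds, ← h1]
  | and c e ih ih' =>
    have h1 := ih (infix_left (infix_tail hc))
    have h2 := ih' (infix_right (infix_tail hc))
    simp [Constraint.truth, Constraint.Holds, h1, h2]
  | or c e ih ih' =>
    have h1 := ih (infix_left (infix_tail hc))
    have h2 := ih' (infix_right (infix_tail hc))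
    simp [Constraint.truth, Constraint.Holds, h1, h2]

end

/-! #### Assignments and tuples -/

section
variable (I : OptInput)

theorem mem_consts {t : Tr} : t ∈ I.consts ↔ ∃ c : Fin I.K, t = constTr c := by
  simp only [OptInput.consts, List.mem_map, List.mem_range, constTr]
  exact ⟨fun ⟨c, hc, e⟩ => ⟨⟨c, hc⟩, e.symm⟩, fun ⟨c, e⟩ => ⟨c, c.isLt, e.symm⟩⟩

theorem mem_tuples {x : List Tr} :
    x ∈ I.tuples ↔ ∃ s : Fin I.N → Fin I.K, x = tupleTr constTr s := by
  have key : ∀ (l : List ℕ), x ∈ (l.map fun _ => I.consts).sections ↔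
      x.length = l.length ∧ ∀ t ∈ x, t ∈ I.consts := by
    intro l
    rw [List.mem_sections]
    induction l generalizing x with
    | nil => cases x <;> simp
    | cons i l ih =>
      cases x with
      | nil => simp
      | cons t x =>
        simp only [List.map_cons, List.forall₂_cons, ih, List.length_cons, List.mem_cons,
          forall_eq_or_imp, Nat.add_right_cancel_iff]
        tauto
  rw [OptInput.tuples, key, List.length_range]
  constructor
  · rintro ⟨h1, h2⟩
    have h3 : ∀ i : Fin I.N, ∃ c : Fin I.K, x[(i : ℕ)]'(by omega) = constTr c := fun i =>
      (mem_consts I).1 (h2 _ (List.getElem_mem _))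
    choose s hs using h3
    refine ⟨s, List.ext_getElem (by simp [tupleTr, h1]) fun i hi _ => ?_⟩
    simpa [tupleTr] using hs ⟨i, by omega⟩
  · rintro ⟨s, rfl⟩
    refine ⟨by simp [tupleTr], fun t ht => ?_⟩
    obtain ⟨i, rfl⟩ := (List.mem_ofFn' _ _).1 ht
    exact (mem_consts I).2 ⟨s i, rfl⟩

theorem exists_agree_of_mem_assigns {ρ : Assign} (hρ : ρ ∈ I.assigns) :
    ∃ σ : ℕ → Fin I.K, ∀ t : Term I.K, Agree ρ σ t := by
  have key : ∀ (l : List Tr) (ρ : Assign),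
      ρ ∈ (l.map fun v => I.consts.map fun c => (v, c)).sections →
      ∀ v, ∃ c : Fin I.K, lookup ρ v = constTr c := by
    intro l
    induction l with
    | nil =>
      intro ρ h v
      obtain rfl : ρ = [] := by simpa [List.sections] using h
      -- A variable without an entry gets the default `leaf`, which encodes the constant `0`; this
      -- exists because there is at least one constant.
      exact ⟨⟨0, I.theory.constants_pos⟩, rfl⟩
    | cons u l ih =>
      intro ρ h v
      rw [List.map_cons, List.mem_sections] at h
      cases h with
      | @cons p _ ρ _ hp hρ =>
        rw [lookup, List.foldr_cons, ← lookup]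
        cases decide (p.1 = v)
        · exact ih _ (List.mem_sections.2 hρ) v
        · obtain ⟨c, hc, rfl⟩ := List.mem_map.1 hp
          exact (mem_consts I).1 hc
  choose σ hσ using fun v : ℕ => key _ _ hρ (enc v)
  refine ⟨σ, fun t => ?_⟩
  cases t with
  | var v => exact hσ v
  | const c => rfl

/-- Every variable that occurs in the word is among the names: reading the suffix that begins with
its digits leaves its number on top of the stack. Names that are not variables do no harm, as they
merely receive some constant. -/
theorem exists_mem_assigns (σ : ℕ → Fin I.K) : ∃ ρ ∈ I.assigns,
    ∀ t : Term I.K, encTerm t <:+: encInput I → Agree ρ σ t := by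
  -- The spine recovers a number from its unary tree and gives a junk index for any other name.
  refine ⟨I.names.map fun v => (v, constTr (σ v.spine)), ?_, fun t ht => ?_⟩
  · rw [OptInput.assigns, List.mem_sections, List.forall₂_map_left_iff,
      List.forall₂_map_right_iff, List.forall₂_same]
    exact fun v _ => List.mem_map.2 ⟨_, (mem_consts I).2 ⟨_, rfl⟩, rfl⟩
  · cases t with
    | const c => rfl
    | var v =>
      have hv : enc v ∈ I.names := by
        obtain ⟨s, r, e⟩ := infix_tail ht
        refine List.mem_map.2 ⟨s.length, List.mem_range.2 ?_, ?_⟩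
        · rw [← e]; simp
        · rw [← e, List.append_assoc, List.drop_left, read_append, read_encNat]; rfl
      have key : ∀ l : List Tr, enc v ∈ l →
          lookup (l.map fun u => (u, constTr (σ u.spine))) (enc v) = constTr (σ v) := by
        intro l
        induction l with
        | nil => simp
        | cons u l ih =>
          intro hl
          rw [List.map_cons, lookup, List.foldr_cons, ← lookup]
          by_cases hu : u = enc v
          · simp [hu]
          · simpa [hu] using ih (by simpa [Ne.symm hu] using hl)
      exact key _ hv

/-! #### Correctness -/

/-- Soundness needs no care about names: each listed assignment agrees with some `σ` on all terms.
Since the trees of ground atoms determine the atoms, the induction hypothesis applies to the goals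
of a rule. -/
theorem derivable_of_entails {t : Tr} (h : Entails I.rules t) :
    ∃ A, I.theory.Derivable A ∧ t = groundTr A := by
  have hinj := Atom.tr_injective (N := I.N) (constTr_injective (K := I.K))
  induction h with
  | intro r hr hc _ ih =>
    have ih' : ∀ A : Atom I.N (Fin I.K), groundTr A ∈ r.2.2 → I.theory.Derivable A := by
      intro A hA
      obtain ⟨B, hB, e⟩ := ih _ hA
      rwa [hinj e]
    simp only [OptInput.rules, List.mem_append, List.mem_flatMap] at hr
    rcases hr with ⟨ρ, hρ, hr⟩ | hr | hr
    · obtain ⟨C, hC, rfl⟩ := List.mem_map.1 hr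
      obtain ⟨σ, hσ⟩ := exists_agree_of_mem_assigns I hρ
      have hσ' : ∀ t : Term I.K, encTerm t <:+: encClause C → Agree ρ σ t := fun t _ => hσ t
      have hi := List.infix_refl (encClause C)
      refine ⟨_, Theory.Derivable.clause C hC σ
        ((truth_of_agree hσ' (infix_left (infix_right hi))).1 hc) fun B hB => ?_,
        head_tr_of_agree hσ' (infix_left hi)⟩
      refine ih' _ (List.mem_map.2 ⟨B, hB, ?_⟩)
      exact atom_tr_of_agree hσ' (infix_of_mem (infix_right (infix_right hi)) hB)
    · simp only [OptInput.featureRules, List.mem_flatMap, List.mem_range, List.mem_map] at hr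
      obtain ⟨i, hi, t, ht, rfl⟩ := hr
      have h1 : i < I.values.length := by simpa [OptInput.values] using hi
      rw [List.drop_eq_getElem_cons h1] at ht
      simp only [OptInput.values, List.headD_cons, List.getElem_ofFn, List.mem_map] at ht
      obtain ⟨c, hmem, rfl⟩ := ht
      exact ⟨_, .feature ⟨i, hi⟩ c hmem, rfl⟩
    · simp only [OptInput.domRules, List.mem_flatMap, List.mem_cons, List.mem_map] at hr
      obtain ⟨x, hx, y, hy, rfl | ⟨z, hz, rfl⟩⟩ := hr
      · obtain ⟨x, rfl⟩ := (mem_tuples I).1 hx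
        obtain ⟨y, rfl⟩ := (mem_tuples I).1 hy
        exact ⟨_, .dom_base x y (ih' _ (by simp [Atom.tr, Head.tr]))
          (ih' _ (by simp [Atom.tr, Head.tr])) (ih' _ (by simp [Atom.tr, Head.tr])), rfl⟩
      · obtain ⟨x, rfl⟩ := (mem_tuples I).1 hx
        obtain ⟨y, rfl⟩ := (mem_tuples I).1 hy
        obtain ⟨z, rfl⟩ := (mem_tuples I).1 hz
        exact ⟨_, .dom_step x z y (ih' _ (by simp [Atom.tr, Head.tr]))
          (ih' _ (by simp [Atom.tr])), rfl⟩

theorem encClause_infix {C : Clause I.N I.K} (hC : C ∈ I.theory.clauses) :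
    encClause C <:+: encInput I :=
  infix_of_mem (infix_left (infix_right (infix_right (infix_right
    (List.infix_refl (encInput I)))))) hC

/-- Only finitely many variables matter for a clause instance, namely those written in the input, so
`σ` may be replaced by a listed assignment. -/
theorem entails_of_derivable {A : Atom I.N (Fin I.K)} (h : I.theory.Derivable A) :
    Entails I.rules (groundTr A) := by
  induction h with
  | feature i c hc =>
    refine Entails.intro (mkAtom 3 (enc (i : ℕ)) (constTr c), true, []) ?_ rfl (by simp)
    refine List.mem_append_right _ (List.mem_append_left _ (List.mem_flatMap.2
      ⟨i, List.mem_range.2 i.isLt, List.mem_map.2 ⟨_, ?_, rfl⟩⟩))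
    have h1 : (i : ℕ) < I.values.length := by simp [OptInput.values]
    rw [List.drop_eq_getElem_cons h1]
    simp only [OptInput.values, List.headD_cons, List.getElem_ofFn, List.mem_map]
    exact ⟨c, hc, rfl⟩
  | clause C hC σ hc hb ih =>
    obtain ⟨ρ, hρ, hσ⟩ := exists_mem_assigns I σ
    have hi := encClause_infix I hC
    have h1 := head_tr_of_agree hσ (infix_left hi)
    have h2 : Entails I.rules (C.rule ρ).1 := by
      refine Entails.intro (C.rule ρ) ?_ ?_ ?_
      · exact List.mem_append_left _ (List.mem_flatMap.2 ⟨ρ, hρ, List.mem_map.2 ⟨C, hC, rfl⟩⟩)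
      · exact (truth_of_agree hσ (infix_left (infix_right hi))).2 hc
      · intro b hb'
        obtain ⟨B, hB, rfl⟩ := List.mem_map.1 hb'
        rw [atom_tr_of_agree hσ (infix_of_mem (infix_right (infix_right hi)) hB)]
        exact ih B hB
    exact (congrArg (Entails I.rules) h1).mp h2
  | dom_base x y _ _ _ hd hx hy =>
    refine Entails.intro (mkAtom 4 (enc (tupleTr constTr x)) (enc (tupleTr constTr y)), true,
      [mkAtom 0 (enc (tupleTr constTr x)) (enc (tupleTr constTr y)),
        mkAtom 1 (enc (tupleTr constTr x)) .leaf,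
          mkAtom 1 (enc (tupleTr constTr y)) .leaf]) ?_ rfl ?_
    · exact List.mem_append_right _ (List.mem_append_right _ (List.mem_flatMap.2
        ⟨_, (mem_tuples I).2 ⟨x, rfl⟩, List.mem_flatMap.2 ⟨_, (mem_tuples I).2 ⟨y, rfl⟩,
          List.mem_cons_self⟩⟩))
    · simp only [List.mem_cons, List.not_mem_nil, or_false, forall_eq_or_imp, forall_eq]
      exact ⟨hd, hx, hy⟩
  | dom_step x z y _ _ hd hz =>
    refine Entails.intro (mkAtom 4 (enc (tupleTr constTr x)) (enc (tupleTr constTr y)), true,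
      [mkAtom 0 (enc (tupleTr constTr x)) (enc (tupleTr constTr z)),
        mkAtom 4 (enc (tupleTr constTr z)) (enc (tupleTr constTr y))]) ?_ rfl ?_
    · exact List.mem_append_right _ (List.mem_append_right _ (List.mem_flatMap.2
        ⟨_, (mem_tuples I).2 ⟨x, rfl⟩, List.mem_flatMap.2 ⟨_, (mem_tuples I).2 ⟨y, rfl⟩,
          List.mem_cons_of_mem _ (List.mem_map.2 ⟨_, (mem_tuples I).2 ⟨z, rfl⟩, rfl⟩)⟩⟩))
    · simp only [List.mem_cons, List.not_mem_nil, or_false, forall_eq_or_imp, forall_eq]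
      exact ⟨hd, hz⟩

theorem isIn_hornClosure_iff (A : Atom I.N (Fin I.K)) :
    isIn (groundTr A) (hornClosure I.rules) = true ↔ I.theory.Derivable A := by
  rw [isIn_iff, mem_hornClosure]
  refine ⟨fun h => ?_, entails_of_derivable I⟩
  obtain ⟨B, hB, e⟩ := derivable_of_entails I h
  rwa [Atom.tr_injective constTr_injective e]

theorem decideOptimal_iff : I.decideOptimal = true ↔ I.theory.IsOptimal I.query := by
  have h1 : ∀ s : Fin I.N → Fin I.K,
      isIn (mkAtom 1 (enc (tupleTr constTr s)) .leaf) (hornClosure I.rules) = true ↔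
        I.theory.IsOutcome s := fun s => isIn_hornClosure_iff I (.ofHead (.outcome s))
  have h2 : ∀ s t : Fin I.N → Fin I.K, isIn (mkAtom 4 (enc (tupleTr constTr s))
      (enc (tupleTr constTr t))) (hornClosure I.rules) = true ↔ I.theory.Dominates s t :=
    fun s t => isIn_hornClosure_iff I (.dom s t)
  have h3 : I.goal = tupleTr constTr I.query := rfl
  rw [OptInput.decideOptimal, optimalIn, Bool.and_eq_true, List.all_eq_true, h3, h1,
    Theory.IsOptimal]
  refine and_congr_right fun _ => ?_
  push Not
  constructor
  · intro h t hne ht hd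
    have := h _ ((mem_tuples I).2 ⟨t, rfl⟩)
    simp only [Bool.or_eq_true, decide_eq_true_eq, Bool.not_eq_true', ← Bool.not_eq_true, h1, h2,
      (tupleTr_injective constTr_injective).eq_iff] at this
    tauto
  · intro h x hx
    obtain ⟨t, rfl⟩ := (mem_tuples I).1 hx
    have := h t
    simp only [Bool.or_eq_true, decide_eq_true_eq, Bool.not_eq_true', ← Bool.not_eq_true, h1, h2,
      (tupleTr_injective constTr_injective).eq_iff]
    tauto

end

end LCP

/-! ### The machine -/

namespace LCP
open StackProg
open Enc (enc)

/-! ### Exponential time bounds. -/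

/-- `t` is bounded by `2` to the power of a polynomial. -/
def ExpBdd (t : ℕ → ℕ) : Prop := ∃ p : Polynomial ℕ, ∀ n, t n ≤ 2 ^ p.eval n

namespace ExpBdd
variable {s t : ℕ → ℕ}

theorem poly (p : Polynomial ℕ) : ExpBdd fun n => p.eval n := ⟨p, fun _ => Nat.lt_two_pow_self.le⟩

theorem const (c : ℕ) : ExpBdd fun _ => c := by simpa using poly (Polynomial.C c)

theorem id : ExpBdd fun n => n := by simpa using poly Polynomial.X

theorem mul (hs : ExpBdd s) (ht : ExpBdd t) : ExpBdd fun n => s n * t n := by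
  obtain ⟨p, hp⟩ := hs
  obtain ⟨q, hq⟩ := ht
  exact ⟨p + q, fun n => by simpa [pow_add] using Nat.mul_le_mul (hp n) (hq n)⟩

theorem add (hs : ExpBdd s) (ht : ExpBdd t) : ExpBdd fun n => s n + t n := by
  obtain ⟨p, hp⟩ := hs
  obtain ⟨q, hq⟩ := ht
  refine ⟨p + q + 1, fun n => ?_⟩
  have h1 : 2 ^ p.eval n ≤ 2 ^ (p.eval n + q.eval n) :=
    Nat.pow_le_pow_right (by norm_num) (by omega)
  have h2 : 2 ^ q.eval n ≤ 2 ^ (p.eval n + q.eval n) :=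
    Nat.pow_le_pow_right (by norm_num) (by omega)
  have h3 := hp n
  have h4 := hq n
  simp only [Polynomial.eval_add, Polynomial.eval_one, pow_succ]
  omega

theorem eval (P : Polynomial ℕ) (ht : ExpBdd t) : ExpBdd fun n => P.eval (t n) := by
  induction P using Polynomial.induction_on' with
  | add p q hp hq => simpa using hp.add hq
  | monomial k c =>
    have h : ExpBdd fun n => t n ^ k := by
      induction k with
      | zero => simpa using const 1
      | succ k ih => simpa only [pow_succ] using ih.mul ht
    simpa using (const c).mul h

end ExpBdd

/-! #### Reading the input -/

/-- Pop a symbol of the input. -/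
def popInput : Pg := .pop none fun _ o => o.map Sum.inl

/-- Push the given bits, then run a program. -/
def pushBits : List Bool → Pg → Pg
  | [], p => p
  | b :: l, p => .seq (lit .m b) (pushBits l p)

/-- Push the tree of the symbol in the register, if it is in the given list, then run a program. -/
noncomputable def pushSymb (p : Pg) : List Symb → Pg
  | [] => p
  | x :: l => .ite (fun v => decide (v = some (.inl x))) (pushBits (enc x).code.reverse p)
      (pushSymb p l)

/-- Turn the input word into a tree. -/
noncomputable def readInput : Pg :=
  .seq (lit .m false) <| .seq popInput <| .loop Option.isSome <|
    pushSymb (.seq (lit .m true) popInput) Finset.univ.toList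

section
open Prog

theorem exec_pushBits {p : Pg} {i : List Symb} {v v' : Rg Symb} {a b c : List Bool}
    {S' : ∀ k, List (Cells Symb k)} {t : ℕ} (l m : List Bool)
    (h : Exec p v (st i (l.reverse ++ m) a b c) v' S' t) :
    Exec (pushBits l p) v (st i m a b c) v' S' (l.length + t) := by
  induction l generalizing m with
  | nil => simpa [pushBits] using h
  | cons x l ih =>
    have h1 := ih (x :: m) (by simpa using h)
    exact Exec.to (Exec.seq exec_lit (by simpa using h1)) (by simp; omega) rfl

theorem exec_pushSymb {p : Pg} {i : List Symb} {x : Symb} {v' : Rg Symb} {m a b c : List Bool}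
    {S' : ∀ k, List (Cells Symb k)} {t : ℕ} {l : List Symb} (hx : x ∈ l)
    (h : Exec p (some (.inl x)) (st i ((enc x).code ++ m) a b c) v' S' t) :
    Exec (pushSymb p l) (some (.inl x)) (st i m a b c) v' S' (l.length + esize x + t) := by
  induction l with
  | nil => simp at hx
  | cons y l ih =>
    by_cases hxy : x = y
    · subst hxy
      refine Exec.to (Exec.ite_true (by simp) (exec_pushBits (enc x).code.reverse m
        (by simpa using h))) ?_ rfl
      simp only [List.length_reverse, Tr.length_code, List.length_cons, esize]
      omega
    · refine Exec.to (Exec.ite_false (by simpa using hxy)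
        (ih (by simpa [hxy] using hx))) ?_ rfl
      simp only [List.length_cons]
      omega

/-- Consing the symbols as they are popped reverses the word, which is why the encoding of inputs
uses the reversed word. -/
theorem exec_readInput (w : List Symb) :
    Exec readInput none (st w [] [] [] []) none (st [] (enc w.reverse).code [] [] [])
      (w.length * (3 * Fintype.card Symb + 10) + 3) := by
  have hpop : ∀ (v : Rg Symb) (w : List Symb) (m : List Bool), Exec popInput v (st w m [] [] [])
      (w.head?.map Sum.inl) (st w.tail m [] [] []) 1 := fun v w m =>
    Exec.to Exec.pop le_rfl (by simp)
  have key : ∀ w acc : List Symb, Exec (.loop Option.isSome <|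
      pushSymb (.seq (lit .m true) popInput) Finset.univ.toList) (w.head?.map Sum.inl)
      (st w.tail (enc acc).code [] [] []) none (st [] (enc (w.reverse ++ acc)).code [] [] [])
      (w.length * (3 * Fintype.card Symb + 10) + 1) := by
    intro w
    induction w with
    | nil => intro acc; simpa using Exec.loop_false rfl
    | cons x w ih =>
      intro acc
      have h1 := esize_symb_le x
      refine Exec.to (Exec.loop_true rfl (exec_pushSymb (x := x) (by simp)
        (Exec.seq exec_lit (by simpa using hpop _ w _))) (by
          simpa [Tr.code] using ih (x :: acc))) ?_ (by simp)
      simp only [Finset.length_toList, Finset.card_univ, List.length_cons, add_one_mul]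
      omega
  refine Exec.to (Exec.seq exec_lit (Exec.seq (by simpa using hpop none w [false])
    (by simpa [Tr.code] using key w []))) (by omega) (by simp)

/-- Turn the tree of a truth value into a bit. -/
def finish : Pg :=
  .seq (pull .m) <| .ite bit (.seq (skim .m) (.seq (skim .m) (lit .m true)))
    (.seq (lit .m false) (skim .c))

theorem exec_finish (r : Bool) :
    Exec finish none (st [] (enc r).code [] [] []) none (st [] [r] [] [] []) 10 := by
  cases r
  · exact Exec.to (Exec.seq exec_pull (Exec.ite_false rfl (Exec.seq exec_lit exec_skim)))
      (by omega) (by simp [Tr.code])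
  · exact Exec.to (Exec.seq exec_pull (Exec.ite_true rfl (Exec.seq exec_skim (Exec.seq exec_skim
      exec_lit)))) (by omega) (by simp [Tr.code])

end

/-! #### Padding the input -/

theorem esize_word_le (w : List Symb) :
    esize w ≤ w.length * (2 * Fintype.card Symb + 2) + 1 :=
  esize_le_of_forall fun x _ => esize_symb_le x

theorem expBdd_pad : ExpBdd fun n => 2 ^ (n * (n + 1)) :=
  ⟨Polynomial.X * (Polynomial.X + 1), fun n => by simp⟩

/-- The output is exponentially long, so this step lies outside `PTime`. A polynomial-time function
prepares the counter `n * (n + 1)` and the number `1`, and the doubling of that number is iterated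
with explicit exponential bounds. -/
theorem exists_pad : ∃ (p : Pg) (t : ℕ → ℕ), ExpBdd t ∧
    ∀ w : List Symb, Does p (enc w) (enc (w, 2 ^ (w.length * (w.length + 1)))) (t w.length) := by
  have h1 : PTime fun w : List Symb => (w.length * (w.length + 1), (w, 1)) := by fun_prop
  have h2 : PTime fun q : List Symb × ℕ => (q.1, q.2 + q.2) := by fun_prop
  obtain ⟨p, t, ⟨P, hP⟩, hp⟩ := h1
  obtain ⟨q, u, ⟨Q, hQ⟩, hq⟩ := h2
  let E : ℕ → ℕ := fun n => n * (2 * Fintype.card Symb + 2) + 1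
  -- `k`, `E` and `B` bound the sizes of the unary counter, of the word, and of the word together
  -- with the growing number.
  let k : ℕ → ℕ := fun n => 2 * (n * (n + 1)) + 1
  let B : ℕ → ℕ := fun n => E n + (2 * 2 ^ (n * (n + 1)) + 1) + 1
  have hE : ExpBdd E := (ExpBdd.id.mul (.const _)).add (.const 1)
  have hk : ExpBdd k := ((ExpBdd.const 2).mul (.mul .id (.add .id (.const 1)))).add (.const 1)
  have hB : ExpBdd B := (hE.add (((ExpBdd.const 2).mul expBdd_pad).add (.const 1))).add (.const 1)
  refine ⟨.seq p (opIter q),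
    fun n => P.eval (E n) + k n * (Q.eval (B n) + 47 * k n + 40 * B n + 60),
    (hE.eval P).add (hk.mul ((((hB.eval Q).add ((ExpBdd.const 47).mul hk)).add
      ((ExpBdd.const 40).mul hB)).add (.const 60))), fun w => ?_⟩
  have hsize : ∀ j ≤ (enc (w.length * (w.length + 1))).spine,
      esize (w, 2 ^ j) ≤ B w.length := by
    intro j hj
    rw [spine_enc_num] at hj
    have h3 := esize_word_le w
    have h4 : 2 ^ j ≤ 2 ^ (w.length * (w.length + 1)) := Nat.pow_le_pow_right (by norm_num) hj
    simp only [esize_pair, esize_num, B, E]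
    omega
  refine Does.seq ((hp w).mono ((hP w).trans (eval_mono P (esize_word_le w)))) ?_
  have h3 := does_opIter (p := q) (enc (w.length * (w.length + 1))) (fun j => enc (w, 2 ^ j))
    (t := Q.eval (B w.length)) (B := B w.length) (fun j hj => ?_) hsize
  · have h4 : (enc (w.length * (w.length + 1))).size = k w.length := esize_num _
    rw [spine_enc_num, h4] at h3
    exact h3
  · have h4 := hq (w, 2 ^ j)
    simp only [← two_mul, ← pow_succ'] at h4
    exact h4.mono ((hQ _).trans (eval_mono Q (hsize j hj.le)))

/-- A program that decides optimality in exponential time. -/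
theorem exists_prog : ∃ (p : Pg) (t : ℕ → ℕ), ExpBdd t ∧ ∀ I : OptInput,
    p.Exec none (st (encInput I) [] [] [] []) none (st [] [I.decideOptimal] [] [] [])
      (t (encInput I).length) := by
  obtain ⟨p, t, ht, hp⟩ := exists_pad
  obtain ⟨q, u, ⟨P, hP⟩, hq⟩ := ptime_decideOptimal
  let E : ℕ → ℕ := fun n =>
    (n * (2 * Fintype.card Symb + 2) + 1) + (2 * 2 ^ (n * (n + 1)) + 1) + 1
  have hE : ExpBdd E := (((ExpBdd.id.mul (.const _)).add (.const 1)).add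
    (((ExpBdd.const 2).mul expBdd_pad).add (.const 1))).add (.const 1)
  refine ⟨.seq readInput (.seq p (.seq q finish)),
    fun n => (n * (3 * Fintype.card Symb + 10) + 3) + (t n + (P.eval (E n) + 10)),
    ((ExpBdd.id.mul (.const _)).add (.const 3)).add (ht.add ((hE.eval P).add (.const 10))),
    fun I => ?_⟩
  have h1 := hp (encInput I).reverse [] []
  have h2 := hq I [] []
  rw [List.length_reverse] at h1
  have h3 : enc ((encInput I).reverse, 2 ^ ((encInput I).length * ((encInput I).length + 1))) =
    enc I := rfl
  rw [h3] at h1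
  simp only [List.append_nil] at h1 h2
  have h4 : u I ≤ P.eval (E (encInput I).length) := by
    refine (hP I).trans (eval_mono P ?_)
    have := esize_word_le (encInput I).reverse
    rw [List.length_reverse] at this
    rw [esize_input, OptInput.pad]
    simp only [E]
    omega
  exact (exec_readInput _).seq (h1.seq ((h2.mono h4).seq (exec_finish _)))

/-! ### From programs to Turing machines. -/

/-- The machine that runs a program. -/
noncomputable def machine (p : Pg) : FinTM2 where
  K := Option Wk
  k₀ := none
  k₁ := some .m
  Γ := Cells Symb
  Λ := Option p.Lab
  main := some p.entry
  ΛFin := letI := p.labFintype; inferInstance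
  σ := Rg Symb
  initialState := none
  Γk₀Fin := inferInstanceAs (Fintype Symb)
  m l := l.elim .halt (p.emit some none)

theorem machine_outputs {p : Pg} {w : List Symb} {r : Bool} {t : ℕ}
    (h : p.Exec none (st w [] [] [] []) none (st [] [r] [] [] []) t) :
    Nonempty (TM2OutputsInTime (machine p) (List.map (Equiv.refl Symb).invFun w)
      (some (List.map (Equiv.refl Bool).invFun (Computability.encodeBool r))) (t + 1)) := by
  obtain ⟨e⟩ := h.evalsTo (machine p).m some none fun _ => rfl
  have h1 : (⟨some (some p.entry), none, st w [] [] [] []⟩ : (machine p).Cfg) =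
      initList (machine p) (List.map (Equiv.refl Symb).invFun w) := by
    unfold initList
    congr 1
    funext k
    rcases k with _ | _ | _ | _ | _
    · exact (List.map_id w).symm
    all_goals rfl
  have h2 : (⟨none, none, st [] [r] [] [] []⟩ : (machine p).Cfg) = haltList (machine p)
      (List.map (Equiv.refl Bool).invFun (Computability.encodeBool r)) := by
    unfold haltList
    congr 1
    funext k
    rcases k with _ | _ | _ | _ | _ <;> rfl
  have e' : EvalsToInTime (machine p).step
      (⟨some (some p.entry), none, st w [] [] [] []⟩ : (machine p).Cfg)
      (some (⟨none, none, st [] [r] [] [] []⟩ : (machine p).Cfg)) (1 + t) :=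
    -- The one extra step executes `halt` at the exit label `none`.
    EvalsToInTime.trans _ _ _ _ _ _ e ⟨⟨1, rfl⟩, le_rfl⟩
  exact ⟨cast (congr (congrArg₂ (fun a b => EvalsToInTime (machine p).step a (some b)) h1 h2)
    (add_comm 1 t)) e'⟩

/-- A program that decides a language, as a machine that computes its characteristic function. -/
noncomputable def decider {α : Type} {e : α → List Symb} {f : α → Bool} (p : Pg) (t : ℕ → ℕ)
    (h : ∀ a, p.Exec none (st (e a) [] [] [] []) none (st [] [f a] [] [] []) (t (e a).length)) :
    TM2ComputableInTime e Computability.encodeBool f where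
  tm := machine p
  inputAlphabet := Equiv.refl Symb
  outputAlphabet := Equiv.refl Bool
  time n := t n + 1
  outputsFun a := (machine_outputs (h a)).some

end LCP

/-- Given a recursive LCP theory and a tuple of values of its features, deciding whether the tuple
is an optimal outcome of the theory is in EXPTIME. -/
theorem theorem7 :
    InEXPTIME LCP.inputEncoding (fun I => I.theory.IsOptimal I.query) := by
  obtain ⟨p, t, ht, hp⟩ := LCP.exists_prog
  refine ⟨LCP.OptInput.decideOptimal, LCP.decideOptimal_iff, LCP.decider p t hp, fun k => ?_,
    ht.add (.const 1)⟩
  rcases k with _ | k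
  · exact inferInstanceAs (Finite LCP.Symb)
  · exact inferInstanceAs (Finite Bool)
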